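/- Conventions. An exact category (in the sense of Quillen) is an additive category $\mathcal A$ together with two classes of morphisms, the inflations and the deflations, each closed under composition and containing all isomorphisms, such that: every inflation has a cokernel which is a deflation, and is a kernel of it; every deflation has a kernel which is an inflation, and is a cokernel of it; for every inflation $X\to Y$ and every morphism $X\to X'$ there is a pushout square in which $X'\to Y'$ is again an inflation; for every deflation $X\to Y$ and every morphism $Y'\to Y$ there is a pullback square in which $X'\to Y'$ is again a deflation. A sequence $X\to Y\to Z$ is a conflation if $X\to Y$ is an inflation with cokernel $Y\to Z$. An abelian category is exact with all monomorphisms as inflations and all epimorphisms as deflations. A functor between exact categories is exact if it sends conflations to conflations; it is fully exact if it is fully faithful and a sequence $X\to Y\to Z$ is a conflation if and only if its image is one. Let $\mathcal A$ be an exact category. A functor $J:\mathcal A\to\mathcal B$ is a cocompletion of $\mathcal A$ if (cc0) $\mathcal B$ is a cocomplete abelian category (with small Hom-sets); (cc1) $J$ is fully exact; (cc2) for every $X\in\mathcal A$, the object $J(X)$ is finitely presented in $\mathcal B$, i.e. $\mathrm{Hom}(J(X),-)$ commutes with filtered colimits; (cc3) for every non-zero $Y\in\mathcal B$ there are $X\in\mathcal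 A$ and a non-zero morphism $J(X)\to Y$; (cc4) for every $X\in\mathcal A$, every epimorphism $\varphi:U\to V$ in $\mathcal B$ and every morphism $f:J(X)\to V$, there are a deflation $g:Y\to X$ of $\mathcal A$ and a morphism $h:J(Y)\to U$ with $\varphi h=f\,J(g)$. The cocompletion is strict if $J$ is moreover an inclusion of categories, i.e. (being fully faithful) is injective on objects; one then writes $\mathcal A\subset\mathcal B$. Theorem 4. Let $\mathcal A$ be an essentially small exact category. 1. $\mathcal A$ has a strict cocompletion. It is unique up to equivalence: if $J:\mathcal A\to\mathcal B$ and $J':\mathcal A\to\mathcal B'$ are strict cocompletions, there is an equivalence $e:\mathcal B\to\mathcal B'$ with $eJ\simeq J'$. 2. If $J:\mathcal A\to\mathcal B$ is a cocompletion of $\mathcal A$, then: (cc5) $\mathcal B$ is a Grothendieck category; (cc6) for every $Y\in\mathcal B$ there are a family $(X_i)_{i\in I}$ of objects of $\mathcal A$, indexed by a set $I$, and an epimorphism $\bigoplus_{i\in I} J(X_i)\to Y$; (cc7) $\mathcal A$ is stable under extensions in $\mathcal B$: for all $X,Y\in\mathcal A$ and every short exact sequence $0\to J(X)\xrightarrow{\alpha}M\xrightarrow{\beta}J(Y)\to0$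 in $\mathcal B$ there are a conflation $X\xrightarrow{i}Z\xrightarrow{p}Y$ of $\mathcal A$ and an isomorphism $e:J(Z)\to M$ with $e\,J(i)=\alpha$ and $\beta e=J(p)$; (cc8) for every morphism $f:X\to Y$ of $\mathcal A$, the morphism $J(f)$ is an epimorphism if and only if there is $Z\in\mathcal A$ such that $(f,0):X\oplus Z\to Y$ is a deflation. 3. Let $\mathcal A'$ be another essentially small exact category, let $J:\mathcal A\to\mathcal A^\vee$ and $J':\mathcal A'\to\mathcal A'^\vee$ be strict cocompletions, and let $F:\mathcal A\to\mathcal A'$ be an exact functor. Then there is a functor $F^\vee:\mathcal A^\vee\to\mathcal A'^\vee$ extending $F$ (that is, $F^\vee J=J'F$) which is right exact and respects (infinite) direct sums. It is unique up to isomorphism: every right exact functor $G:\mathcal A^\vee\to\mathcal A'^\vee$ that respects direct sums and satisfies $GJ\simeq J'F$ is isomorphic to $F^\vee$. -/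

import Mathlib

open CategoryTheory CategoryTheory.Limits

universe w v u v₁ u₁ v₂ u₂ u₃

/-- An exact structure in the sense of Quillen on an additive category: a class of inflations and
a class of deflations, both closed under composition and containing the isomorphisms. Inflations
and deflations are matched with each other by kernel-cokernel pairs. -/
structure ExactStructure (A : Type u) [Category.{v} A] [Preadditive A]
    [HasZeroObject A] [HasBinaryBiproducts A] where
  /-- the inflations -/
  inflation : MorphismProperty A
  /-- the deflations -/
  deflation : MorphismProperty A
  inflation_of_isIso : ∀ {X Y : A} (f : X ⟶ Y) [IsIso f], inflation f
  deflation_of_isIso : ∀ {X Y : A} (f : X ⟶ Y) [IsIso f], deflation f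
  inflation_comp : ∀ {X Y Z : A} (f : X ⟶ Y) (g : Y ⟶ Z),
    inflation f → inflation g → inflation (f ≫ g)
  deflation_comp : ∀ {X Y Z : A} (f : X ⟶ Y) (g : Y ⟶ Z),
    deflation f → deflation g → deflation (f ≫ g)
  /-- every inflation has a cokernel which is a deflation, and is the kernel of that cokernel -/
  exists_cokernel : ∀ {X Y : A} (f : X ⟶ Y), inflation f →
    ∃ (Z : A) (g : Y ⟶ Z) (zero : f ≫ g = 0), deflation g ∧
      Nonempty (IsColimit (CokernelCofork.ofπ g zero)) ∧
      Nonempty (IsLimit (KernelFork.ofι f zero))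
  /-- every deflation has a kernel which is an inflation, and is the cokernel of that kernel -/
  exists_kernel : ∀ {Y Z : A} (g : Y ⟶ Z), deflation g →
    ∃ (X : A) (f : X ⟶ Y) (zero : f ≫ g = 0), inflation f ∧
      Nonempty (IsLimit (KernelFork.ofι f zero)) ∧
      Nonempty (IsColimit (CokernelCofork.ofπ g zero))
  /-- inflations are stable under cobase change -/
  cobase_change : ∀ {X Y X' : A} (f : X ⟶ Y) (g : X ⟶ X'), inflation f →
    ∃ (Y' : A) (g' : Y ⟶ Y') (f' : X' ⟶ Y'), IsPushout f g g' f' ∧ inflation f'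
  /-- deflations are stable under base change -/
  base_change : ∀ {X Y Y' : A} (f : X ⟶ Y) (g : Y' ⟶ Y), deflation f →
    ∃ (X' : A) (g' : X' ⟶ X) (f' : X' ⟶ Y'), IsPullback g' f' f g ∧ deflation f'

namespace ExactStructure

/-- `X ⟶ Y ⟶ Z` is a conflation if `X ⟶ Y` is an inflation with cokernel `Y ⟶ Z`. -/
def Conflation {A : Type u} [Category.{v} A] [Preadditive A] [HasZeroObject A]
    [HasBinaryBiproducts A] (E : ExactStructure A) {X Y Z : A} (f : X ⟶ Y) (g : Y ⟶ Z) : Prop :=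
  E.inflation f ∧ ∃ zero : f ≫ g = 0, Nonempty (IsColimit (CokernelCofork.ofπ g zero))

/-- The exact structure of an abelian category: all monomorphisms are inflations and all
epimorphisms are deflations. -/
def ofAbelian (B : Type u) [Category.{v} B] [Abelian B] : ExactStructure B where
  inflation := MorphismProperty.monomorphisms B
  deflation := MorphismProperty.epimorphisms B
  inflation_of_isIso f _ := MorphismProperty.monomorphisms.infer_property f
  deflation_of_isIso f _ := MorphismProperty.epimorphisms.infer_property f
  inflation_comp f g hf hg := MorphismProperty.comp_mem _ f g hf hg
  deflation_comp f g hf hg := MorphismProperty.comp_mem _ f g hf hg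
  exists_cokernel f hf := by
    have : Mono f := hf
    exact ⟨cokernel f, cokernel.π f, cokernel.condition f,
      MorphismProperty.epimorphisms.infer_property _, ⟨cokernelIsCokernel f⟩,
      ⟨Abelian.monoIsKernelOfCokernel
        (CokernelCofork.ofπ (cokernel.π f) (cokernel.condition f)) (cokernelIsCokernel f)⟩⟩
  exists_kernel g hg := by
    have : Epi g := hg
    exact ⟨kernel g, kernel.ι g, kernel.condition g,
      MorphismProperty.monomorphisms.infer_property _, ⟨kernelIsKernel g⟩,
      ⟨Abelian.epiIsCokernelOfKernel
        (KernelFork.ofι (kernel.ι g) (kernel.condition g)) (kernelIsKernel g)⟩⟩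
  cobase_change f g hf := by
    have : Mono f := hf
    exact ⟨pushout f g, pushout.inl f g, pushout.inr f g, IsPushout.of_hasPushout f g,
      MorphismProperty.monomorphisms.infer_property _⟩
  base_change f g hf := by
    have : Epi f := hf
    exact ⟨pullback f g, pullback.fst f g, pullback.snd f g, IsPullback.of_hasPullback f g,
      MorphismProperty.epimorphisms.infer_property _⟩

variable {A : Type u₁} [Category.{v₁} A] [Preadditive A] [HasZeroObject A] [HasBinaryBiproducts A]
  {B : Type u₂} [Category.{v₂} B] [Preadditive B] [HasZeroObject B] [HasBinaryBiproducts B]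

/-- An exact functor is a functor that respects conflations. -/
def IsExactFunctor (EA : ExactStructure A) (EB : ExactStructure B) (F : A ⥤ B) : Prop :=
  ∀ ⦃X Y Z : A⦄ (f : X ⟶ Y) (g : Y ⟶ Z),
    EA.Conflation f g → EB.Conflation (F.map f) (F.map g)

/-- A functor is fully exact if it is fully faithful and if it respects and detects
conflations. -/
structure IsFullyExact (EA : ExactStructure A) (EB : ExactStructure B) (F : A ⥤ B) : Prop where
  full : F.Full
  faithful : F.Faithful
  conflation_iff : ∀ ⦃X Y Z : A⦄ (f : X ⟶ Y) (g : Y ⟶ Z),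
    EA.Conflation f g ↔ EB.Conflation (F.map f) (F.map g)

end ExactStructure

section Cocompletion

variable {A : Type u} [Category.{v} A] [Preadditive A] [HasZeroObject A] [HasBinaryBiproducts A]
  {B : Type u₁} [Category.{w} B] [Abelian B]

/-- The functor `F : A ⥤ B` is a cocompletion of the exact category `A`. Smallness is relative to
the universe `w`, and the morphisms of `B` between two objects form a small set. -/
structure IsCocompletion (E : ExactStructure A) (F : A ⥤ B) : Prop where
  /-- the abelian category `B` is cocomplete -/
  cocomplete : HasColimitsOfSize.{w, w} B
  /-- `A` is fully exact in `B` -/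
  fullyExact : E.IsFullyExact (ExactStructure.ofAbelian B) F
  /-- objects coming from `A` are finitely presented (compact) in `B` -/
  finitelyPresented : ∀ X : A, IsFinitelyPresentable.{w} (F.obj X)
  /-- every nonzero object of `B` receives a nonzero morphism from an object of `A` -/
  exists_ne_zero : ∀ Y : B, ¬ IsZero Y → ∃ (X : A) (f : F.obj X ⟶ Y), f ≠ 0
  /-- morphisms from `A` lift through epimorphisms of `B` after a deflation of `A` -/
  exists_lift : ∀ (X : A) {U V : B} (φ : U ⟶ V) [Epi φ] (f : F.obj X ⟶ V),
    ∃ (Y : A) (g : Y ⟶ X) (h : F.obj Y ⟶ U), E.deflation g ∧ h ≫ φ = F.map g ≫ f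

/-- A cocompletion is strict if it is an inclusion of categories. Since cocompletions are fully
faithful, this means that the functor is injective on objects. -/
structure IsStrictCocompletion (E : ExactStructure A) (F : A ⥤ B) : Prop
    extends IsCocompletion E F where
  injective_obj : Function.Injective F.obj

/-- Every object of `B` is a quotient of a small direct sum of objects coming from `A`. -/
def GeneratedByDirectSums (F : A ⥤ B) : Prop :=
  ∀ Y : B, ∃ (ι : Type w) (X : ι → A) (_ : HasCoproduct fun i => F.obj (X i))
    (p : (∐ fun i => F.obj (X i)) ⟶ Y), Epi p

/-- `A` is stable under extensions in `B`. -/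
def StableUnderExtensions (E : ExactStructure A) (F : A ⥤ B) : Prop :=
  ∀ (X Y : A) (M : B) (α : F.obj X ⟶ M) (β : M ⟶ F.obj Y),
    (ExactStructure.ofAbelian B).Conflation α β →
      ∃ (Z : A) (i : X ⟶ Z) (p : Z ⟶ Y) (e : F.obj Z ≅ M),
        E.Conflation i p ∧ F.map i ≫ e.hom = α ∧ e.hom ≫ β = F.map p

/-- A morphism `f : X ⟶ Y` of `A` becomes an epimorphism in `B` if and only if
`(f, 0) : X ⊞ Z ⟶ Y` is a deflation for some `Z`. -/
def EpiIffStablyDeflation (E : ExactStructure A) (F : A ⥤ B) : Prop :=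
  ∀ ⦃X Y : A⦄ (f : X ⟶ Y),
    Epi (F.map f) ↔ ∃ Z : A, E.deflation (biprod.desc f (0 : Z ⟶ Y))

end Cocompletion

/-- A functor is right exact and respects (infinite) direct sums indexed by small sets. -/
structure IsRightExactRespectingDirectSums {B : Type u₁} [Category.{w} B] {B' : Type u₂}
    [Category.{w} B'] (G : B ⥤ B') : Prop where
  rightExact : PreservesFiniteColimits G
  directSums : ∀ ι : Type w, PreservesColimitsOfShape (Discrete ι) G

/-! The model is the Gabriel–Quillen embedding. Let `C` be a small category equivalent to `A`. Call
a sieve covering if it contains a deflation. For additive presheaves of abelian groups, the sheaf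
condition says exactly that conflations go to left exact sequences, and the additive sheaves form a
cocomplete abelian category. Covers consist of single deflations, so filtered colimits of sheaves
are pointwise and representables are finitely presented. Epimorphisms are the locally surjective
maps, which is (cc4) by Yoneda. Hence the Yoneda embedding is a cocompletion
(`isCocompletion_yonedaSheaf`). That it detects conflations rests on
`inflation_of_isLimit_of_deflation_comp`, a form of Quillen's "obscure axiom".

Every cocompletion `J : C ⥤ B` is equivalent to this one through `Y ↦ Hom(J -, Y)`
(`isEquivalence_homSheaf`). Full faithfulness is `exists_hom_of_naturality`: `Y` is a quotient of a
sum of objects `J X`, and by finite presentation its relations are visible on finite sums, which lie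
in `C`. The functor is exact by (cc4) and commutes with filtered colimits by (cc2). Its image
contains the representables, from which finite coproducts, cokernels and filtered colimits build
everything (`prop_of_isClosedUnderColimits`). Uniqueness and the Grothendieck property follow.

If `H : C ⥤ B'` is right exact on conflations, `Z ↦ Hom(H -, Z)` lands in additive sheaves and has a
left adjoint, sending the representable of `X` to `H X`; this is the extension of `H`. It is unique
because `J` is dense. Strictness is bookkeeping: copies of the objects of `A` are added to `B`, and
functors are modified within their isomorphism class. -/

namespace ExactStructure

open scoped ZeroObject

/-! ### Elementary calculus of inflations, deflations and conflations -/

section Basic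

variable {A : Type u} [Category.{v} A] [Preadditive A] [HasZeroObject A] [HasBinaryBiproducts A]
  (E : ExactStructure A)

lemma deflation_of_isPullback {X' X Y' Y : A} {g' : X' ⟶ X} {f' : X' ⟶ Y'} {f : X ⟶ Y}
    {g : Y' ⟶ Y} (sq : IsPullback g' f' f g) (hf : E.deflation f) : E.deflation f' := by
  obtain ⟨P, a, b, sq', hb⟩ := E.base_change f g hf
  have : f' = (sq.isoIsPullback _ _ sq').hom ≫ b := by simp
  rw [this]
  exact E.deflation_comp _ _ (E.deflation_of_isIso _) hb

lemma inflation_of_isPushout {X Y X' Y' : A} {f : X ⟶ Y} {g : X ⟶ X'} {g' : Y ⟶ Y'}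
    {f' : X' ⟶ Y'} (sq : IsPushout f g g' f') (hf : E.inflation f) : E.inflation f' := by
  obtain ⟨P, a, b, sq', hb⟩ := E.cobase_change f g hf
  have : f' = b ≫ (sq'.isoIsPushout _ _ sq).hom := by simp
  rw [this]
  exact E.inflation_comp _ _ hb (E.inflation_of_isIso _)

lemma deflation_of_isColimit {X Y Z : A} {f : X ⟶ Y} {g : Y ⟶ Z} (hf : E.inflation f)
    (zero : f ≫ g = 0) (hg : IsColimit (CokernelCofork.ofπ g zero)) : E.deflation g := by
  obtain ⟨Z', g', zero', hg', ⟨h⟩, -⟩ := E.exists_cokernel f hf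
  have : g = g' ≫ (h.coconePointUniqueUpToIso hg).hom :=
    (h.comp_coconePointUniqueUpToIso_hom hg WalkingParallelPair.one).symm
  rw [this]
  exact E.deflation_comp _ _ hg' (E.deflation_of_isIso _)

lemma inflation_of_isLimit {X Y Z : A} {f : X ⟶ Y} {g : Y ⟶ Z} (hg : E.deflation g)
    (zero : f ≫ g = 0) (hf : IsLimit (KernelFork.ofι f zero)) : E.inflation f := by
  obtain ⟨Z', f', zero', hf', ⟨h⟩, -⟩ := E.exists_kernel g hg
  have : f = (hf.conePointUniqueUpToIso h).hom ≫ f' :=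
    (hf.conePointUniqueUpToIso_hom_comp h WalkingParallelPair.zero).symm
  rw [this]
  exact E.inflation_comp _ _ (E.inflation_of_isIso _) hf'

variable {E}

lemma Conflation.zero {X Y Z : A} {f : X ⟶ Y} {g : Y ⟶ Z} (h : E.Conflation f g) :
    f ≫ g = 0 := h.2.1

lemma Conflation.deflation {X Y Z : A} {f : X ⟶ Y} {g : Y ⟶ Z} (h : E.Conflation f g) :
    E.deflation g :=
  E.deflation_of_isColimit h.1 h.2.1 h.2.2.some

lemma Conflation.epi {X Y Z : A} {f : X ⟶ Y} {g : Y ⟶ Z} (h : E.Conflation f g) : Epi g :=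
  epi_of_isColimit_cofork h.2.2.some

lemma Conflation.exists_desc {X Y Z T : A} {f : X ⟶ Y} {g : Y ⟶ Z} (h : E.Conflation f g)
    (k : Y ⟶ T) (hk : f ≫ k = 0) : ∃ l, g ≫ l = k :=
  ⟨_, (CokernelCofork.IsColimit.desc' h.2.2.some k hk).2⟩

/-- The axioms make `f` a kernel of some cokernel `g'` only. But `g'` factors through `g`, so
whatever `g` kills is killed by `g'`. -/
lemma Conflation.nonempty_isLimit {X Y Z : A} {f : X ⟶ Y} {g : Y ⟶ Z} (h : E.Conflation f g) :
    Nonempty (IsLimit (KernelFork.ofι f h.zero)) := by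
  obtain ⟨Z', g', zero', hg', ⟨hc⟩, ⟨hl⟩⟩ := E.exists_cokernel f h.1
  obtain ⟨t, ht⟩ := CokernelCofork.IsColimit.desc' h.2.2.some g' zero'
  have : Mono f := mono_of_isLimit_fork hl
  refine ⟨KernelFork.IsLimit.ofι' f h.zero fun k hk => KernelFork.IsLimit.lift' hl k ?_⟩
  have ht : g ≫ t = g' := ht
  rw [← ht, reassoc_of% hk, zero_comp]

lemma Conflation.mono {X Y Z : A} {f : X ⟶ Y} {g : Y ⟶ Z} (h : E.Conflation f g) : Mono f :=
  mono_of_isLimit_fork h.nonempty_isLimit.some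

lemma Conflation.exists_lift {X Y Z T : A} {f : X ⟶ Y} {g : Y ⟶ Z} (h : E.Conflation f g)
    (k : T ⟶ Y) (hk : k ≫ g = 0) : ∃ l, l ≫ f = k :=
  ⟨_, (KernelFork.IsLimit.lift' h.nonempty_isLimit.some k hk).2⟩

lemma exists_conflation_of_deflation {Y Z : A} {g : Y ⟶ Z} (hg : E.deflation g) :
    ∃ (X : A) (f : X ⟶ Y), E.Conflation f g := by
  obtain ⟨X, f, zero, hf, -, h⟩ := E.exists_kernel g hg
  exact ⟨X, f, hf, zero, h⟩

lemma exists_conflation_of_inflation {X Y : A} {f : X ⟶ Y} (hf : E.inflation f) :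
    ∃ (Z : A) (g : Y ⟶ Z), E.Conflation f g := by
  obtain ⟨Z, g, zero, -, h, -⟩ := E.exists_cokernel f hf
  exact ⟨Z, g, hf, zero, h⟩

variable (E)

lemma conflation_id_zero (X : A) : E.Conflation (𝟙 X) (0 : X ⟶ 0) :=
  ⟨E.inflation_of_isIso _, by simp, ⟨CokernelCofork.IsColimit.ofπ' _ _ fun k hk =>
    ⟨0, by simpa using hk.symm⟩⟩⟩

lemma inflation_zero (X : A) : E.inflation (0 : (0 : A) ⟶ X) := by
  refine E.inflation_of_isLimit (E.deflation_of_isIso (𝟙 X)) (by simp)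
    (KernelFork.IsLimit.ofι' _ _ fun k hk => ⟨0, by simpa using hk.symm⟩)

lemma inflation_inl (X Y : A) : E.inflation (biprod.inl : X ⟶ X ⊞ Y) :=
  E.inflation_of_isPushout (IsPushout.of_has_biproduct X Y).flip (E.inflation_zero Y)

lemma conflation_inl_snd (X Y : A) :
    E.Conflation (biprod.inl : X ⟶ X ⊞ Y) (biprod.snd : X ⊞ Y ⟶ Y) :=
  ⟨E.inflation_inl X Y, by simp, ⟨CokernelCofork.IsColimit.ofπ' _ _ fun k hk =>
    ⟨biprod.inr ≫ k, by ext <;> simp [hk]⟩⟩⟩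

lemma deflation_snd (X Y : A) : E.deflation (biprod.snd : X ⊞ Y ⟶ Y) :=
  (E.conflation_inl_snd X Y).deflation

/-- The shear automorphism of `X ⊞ Y` given by `f : X ⟶ Y`. -/
@[simps]
noncomputable def shear {X Y : A} (f : X ⟶ Y) : X ⊞ Y ≅ X ⊞ Y where
  hom := biprod.lift biprod.fst (biprod.fst ≫ f + biprod.snd)
  inv := biprod.lift biprod.fst (biprod.snd - biprod.fst ≫ f)

/-- Up to a shear, this is `1 ⊕ g`, a base change of `g`, followed by a projection. -/
lemma deflation_desc {X W Y : A} (f : X ⟶ Y) {g : W ⟶ Y} (hg : E.deflation g) :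
    E.deflation (biprod.desc f g) := by
  have h₁ : E.deflation (biprod.map (𝟙 X) g) := by
    refine E.deflation_of_isPullback (g := (biprod.snd : X ⊞ Y ⟶ Y)) (g' := biprod.snd) ?_ hg
    refine ⟨⟨by simp⟩, ⟨PullbackCone.IsLimit.mk _
      (fun s => biprod.lift (s.snd ≫ biprod.fst) s.fst) (by simp) ?_ ?_⟩⟩
    · intro s
      ext <;> simp [s.condition]
    · intro s m hm₁ hm₂
      ext <;> simp [← hm₁, ← hm₂]
  have h₂ : biprod.desc f g = biprod.map (𝟙 X) g ≫ (shear f).hom ≫ biprod.snd := by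
    ext <;> simp
  rw [h₂]
  exact E.deflation_comp _ _ h₁
    (E.deflation_comp _ _ (E.deflation_of_isIso _) (E.deflation_snd _ _))

/-- A column operation by `h` turns `(f, 0)` into `(f, h ≫ f)`. -/
lemma deflation_desc_zero {X W Y : A} {f : X ⟶ Y} {h : W ⟶ X} (hf : E.deflation (h ≫ f)) :
    E.deflation (biprod.desc f (0 : W ⟶ Y)) := by
  have : biprod.desc f (0 : W ⟶ Y) =
      (biprod.braiding X W).hom ≫ (shear (-h)).hom ≫ (biprod.braiding W X).hom ≫
        biprod.desc f (h ≫ f) := by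
    ext <;> simp
  rw [this]
  exact E.deflation_comp _ _ (E.deflation_of_isIso _) (E.deflation_comp _ _
    (E.deflation_of_isIso _) (E.deflation_comp _ _ (E.deflation_of_isIso _)
      (E.deflation_desc f hf)))

lemma inflation_lift {K W X : A} {k : K ⟶ W} (t : K ⟶ X) (hk : E.inflation k) :
    E.inflation (biprod.lift k t) := by
  have h₁ : E.inflation (biprod.map k (𝟙 X)) := by
    refine E.inflation_of_isPushout (g := (biprod.inl : K ⟶ K ⊞ X)) (g' := biprod.inl) ?_ hk
    refine ⟨⟨by simp⟩, ⟨PushoutCocone.IsColimit.mk _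
      (fun s => biprod.desc s.inl (biprod.inr ≫ s.inr)) (by simp) ?_ ?_⟩⟩
    · intro s
      ext <;> simp [s.condition]
    · intro s m hm₁ hm₂
      ext <;> simp [← hm₁, ← hm₂]
  have h₂ : biprod.lift k t = biprod.inl ≫ (shear t).hom ≫ biprod.map k (𝟙 X) := by
    ext <;> simp
  rw [h₂]
  exact E.inflation_comp _ _ (E.inflation_inl _ _)
    (E.inflation_comp _ _ (E.inflation_of_isIso _) h₁)

/-- A kernel of a morphism `g` is an inflation as soon as `h ≫ g` is a deflation for some `h`. -/
lemma inflation_of_isLimit_of_deflation_comp {X Y Z W : A} {f : X ⟶ Y} {g : Y ⟶ Z} {h : W ⟶ Y}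
    (hg : E.deflation (h ≫ g)) (zero : f ≫ g = 0) (hf : IsLimit (KernelFork.ofι f zero)) :
    E.inflation f := by
  have : Mono f := mono_of_isLimit_fork hf
  -- `f ⊕ 1` is a kernel of the deflation `(g, 0) : Y ⊞ W ⟶ Z`. Pushing it out along the projection
  -- `X ⊞ W ⟶ X` then recovers `f`.
  have h₁ : E.inflation (biprod.map f (𝟙 W)) := by
    refine E.inflation_of_isLimit (E.deflation_desc_zero hg) (by ext <;> simp [zero])
      (KernelFork.IsLimit.ofι' _ _ fun k hk => ?_)
    have hk' : (k ≫ biprod.fst) ≫ g = 0 := by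
      rw [← hk, Category.assoc]
      congr 1
      ext <;> simp
    obtain ⟨l, hl⟩ := KernelFork.IsLimit.lift' hf _ hk'
    refine ⟨biprod.lift l (k ≫ biprod.snd), ?_⟩
    have hl : l ≫ f = k ≫ biprod.fst := hl
    ext <;> simp [hl]
  refine E.inflation_of_isPushout (g := biprod.fst) (g' := biprod.fst) ?_ h₁
  refine ⟨⟨by simp⟩, ⟨PushoutCocone.IsColimit.mk _ (fun s => biprod.inl ≫ s.inl) ?_ ?_ ?_⟩⟩
  · intro s
    have := biprod.inr ≫= s.condition
    simp at this
    ext <;> simp [this]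
  · intro s
    have := biprod.inl ≫= s.condition
    simpa using this
  · intro s m hm₁ hm₂
    simp [← hm₁]

end Basic

/-! ### Functors that are right exact on conflations -/

section RightExact

variable {A : Type u₁} [Category.{v₁} A] [Preadditive A] [HasZeroObject A] [HasBinaryBiproducts A]
  {B : Type u₂} [Category.{v₂} B] [Preadditive B]

/-- A functor is right exact on conflations if it sends the deflation of every conflation to a
cokernel of the image of the inflation. -/
def IsRightExactOn (E : ExactStructure A) (H : A ⥤ B) : Prop :=
  ∀ ⦃X Y Z : A⦄ (f : X ⟶ Y) (g : Y ⟶ Z), E.Conflation f g →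
    ∃ zero : H.map f ≫ H.map g = 0, Nonempty (IsColimit (CokernelCofork.ofπ (H.map g) zero))

variable {E : ExactStructure A} {H : A ⥤ B}

lemma IsRightExactOn.exists_desc (hH : E.IsRightExactOn H) {X Y Z : A} {f : X ⟶ Y} {g : Y ⟶ Z}
    (h : E.Conflation f g) {T : B} (k : H.obj Y ⟶ T) (hk : H.map f ≫ k = 0) :
    ∃ l, H.map g ≫ l = k :=
  ⟨_, (CokernelCofork.IsColimit.desc' (hH f g h).2.some k hk).2⟩

lemma IsRightExactOn.epi (hH : E.IsRightExactOn H) {Y Z : A} {g : Y ⟶ Z}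
    (hg : E.deflation g) : Epi (H.map g) := by
  obtain ⟨X, f, h⟩ := exists_conflation_of_deflation hg
  exact epi_of_isColimit_cofork (hH f g h).2.some

/-- The conflation `0 ⟶ 0 ⟶ 0` forces the identity of `H.obj 0` to vanish, and every zero morphism
factors through `0`. -/
lemma IsRightExactOn.map_zero (hH : E.IsRightExactOn H) (X Y : A) :
    H.map (0 : X ⟶ Y) = 0 := by
  have h := (hH _ _ (E.conflation_id_zero (0 : A))).1
  have h' : 𝟙 (H.obj (0 : A)) = 0 := by
    rw [← H.map_id, ← h, ← H.map_comp]
    congr 1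
    subsingleton
  have : (0 : X ⟶ Y) = (0 : X ⟶ 0) ≫ 𝟙 _ ≫ (0 : (0 : A) ⟶ Y) := by simp
  rw [this, H.map_comp, H.map_comp, H.map_id, h', zero_comp, comp_zero]

/-- It suffices to treat the sum map `X ⊞ X ⟶ X`. The difference `H(fst + snd) - H(fst)` vanishes on
the first summand, so it factors through `H(snd)`; restricting to the second summand shows that the
factor is the identity. -/
lemma IsRightExactOn.additive (hH : E.IsRightExactOn H) : H.Additive := by
  have key (X : A) : H.map (biprod.fst + biprod.snd : X ⊞ X ⟶ X) =
      H.map biprod.fst + H.map biprod.snd := by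
    obtain ⟨l, hl⟩ := hH.exists_desc (E.conflation_inl_snd X X)
      (H.map (biprod.fst + biprod.snd : X ⊞ X ⟶ X) - H.map biprod.fst) (by
        rw [Preadditive.comp_sub, ← H.map_comp, ← H.map_comp]
        simp)
    have hl' := H.map biprod.inr ≫= hl
    rw [← H.map_comp_assoc, Preadditive.comp_sub, ← H.map_comp, ← H.map_comp] at hl'
    simp only [biprod.inr_snd, H.map_id, Category.id_comp, Preadditive.comp_add,
      biprod.inr_fst, zero_add, hH.map_zero, sub_zero] at hl'
    rw [hl', Category.comp_id] at hl
    rw [hl]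
    abel
  refine ⟨fun {X Y f g} => ?_⟩
  have : f + g = biprod.lift f g ≫ (biprod.fst + biprod.snd) := by simp
  rw [this, H.map_comp, key, Preadditive.comp_add, ← H.map_comp, ← H.map_comp]
  simp

lemma isRightExactOn_id : E.IsRightExactOn (𝟭 A) := fun _ _ _ _ _ h => h.2

lemma IsExactFunctor.isRightExactOn [HasZeroObject B] [HasBinaryBiproducts B]
    {EB : ExactStructure B} (hH : E.IsExactFunctor EB H) : E.IsRightExactOn H :=
  fun _ _ _ f g h => (hH f g h).2

lemma IsExactFunctor.comp_isRightExactOn [HasZeroObject B] [HasBinaryBiproducts B]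
    {EB : ExactStructure B} (hH : E.IsExactFunctor EB H) {B' : Type u₃} [Category.{w} B']
    [Preadditive B'] {H' : B ⥤ B'} (hH' : EB.IsRightExactOn H') : E.IsRightExactOn (H ⋙ H') :=
  fun _ _ _ f g h => hH' _ _ (hH f g h)

lemma IsFullyExact.isExactFunctor [HasZeroObject B] [HasBinaryBiproducts B]
    {EB : ExactStructure B} (hH : E.IsFullyExact EB H) : E.IsExactFunctor EB H :=
  fun _ _ _ f g h => (hH.conflation_iff f g).1 h

end RightExact

section Abelian

variable {B : Type u} [Category.{v} B] [Abelian B]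

lemma ofAbelian_conflation_of_isLimit {X Y Z : B} {f : X ⟶ Y} {g : Y ⟶ Z} [Epi g]
    (zero : f ≫ g = 0) (hf : IsLimit (KernelFork.ofι f zero)) :
    (ofAbelian B).Conflation f g :=
  ⟨mono_of_isLimit_fork hf, zero, ⟨Abelian.epiIsCokernelOfKernel _ hf⟩⟩

end Abelian

end ExactStructure

/-! ### Epimorphisms and extensions in a cocompletion -/

namespace IsCocompletion

variable {A : Type u} [Category.{v} A] [Preadditive A] [HasZeroObject A] [HasBinaryBiproducts A]
  {B : Type u₁} [Category.{w} B] [Abelian B] {E : ExactStructure A} {J : A ⥤ B}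

lemma isRightExactOn (h : IsCocompletion E J) : E.IsRightExactOn J :=
  h.fullyExact.isExactFunctor.isRightExactOn

theorem epiIffStablyDeflation (h : IsCocompletion E J) : EpiIffStablyDeflation E J := by
  intro X Y f
  constructor
  · intro hf
    have := h.fullyExact.full
    have := h.fullyExact.faithful
    -- Lifting the identity through `J.map f` exhibits a deflation that factors through `f`.
    obtain ⟨W, g, k, hg, hk⟩ := h.exists_lift Y (J.map f) (𝟙 _)
    obtain ⟨l, rfl⟩ := J.map_surjective k
    rw [Category.comp_id, ← J.map_comp] at hk
    rw [← J.map_injective hk] at hg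
    exact ⟨W, E.deflation_desc_zero hg⟩
  · rintro ⟨Z, hZ⟩
    have : Epi (J.map (biprod.desc f (0 : Z ⟶ Y))) := h.isRightExactOn.epi hZ
    have e : biprod.desc f (0 : Z ⟶ Y) = biprod.fst ≫ f := by ext <;> simp
    rw [e, J.map_comp] at this
    exact epi_of_epi (J.map (biprod.fst : X ⊞ Z ⟶ X)) (J.map f)

/-- After a deflation `g : W ⟶ Y` with kernel `i : K ⟶ W`, the epimorphism `β` acquires a partial
section `k`, whose restriction to `K` is a map `t : K ⟶ X`. Then `M` is the pushout of `i` along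
`t`. This pushout exists in `A`, as the cokernel `Z` of the inflation `(i, -t)`, and `J` preserves
that cokernel. -/
theorem stableUnderExtensions (h : IsCocompletion E J) : StableUnderExtensions E J := by
  intro X Y M α β hαβ
  have := h.fullyExact.full
  have := h.fullyExact.faithful
  have := h.isRightExactOn.additive
  have : Mono α := hαβ.mono
  have : Epi β := hαβ.epi
  obtain ⟨W, g, k, hg, hk⟩ := h.exists_lift Y β (𝟙 _)
  rw [Category.comp_id] at hk
  obtain ⟨K, i, hig⟩ := ExactStructure.exists_conflation_of_deflation hg
  have hJig := (h.fullyExact.conflation_iff i g).1 hig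
  have : Epi (J.map g) := hJig.epi
  obtain ⟨t', ht'⟩ := hαβ.exists_lift (J.map i ≫ k) (by
    rw [Category.assoc, hk, hJig.zero])
  obtain ⟨t, rfl⟩ := J.map_surjective t'
  obtain ⟨Z, q, hq⟩ := ExactStructure.exists_conflation_of_inflation
    (E.inflation_lift (-t) hig.1)
  have hJq := (h.fullyExact.conflation_iff _ q).1 hq
  have : Mono (J.map (biprod.lift i (-t))) := hJq.mono
  let r : J.obj (W ⊞ X) ⟶ M := J.map biprod.fst ≫ k + J.map biprod.snd ≫ α
  have hr₁ : J.map biprod.inl ≫ r = k := by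
    simp only [r, Preadditive.comp_add, ← J.map_comp_assoc]
    simp
  have hr₂ : J.map biprod.inr ≫ r = α := by
    simp only [r, Preadditive.comp_add, ← J.map_comp_assoc]
    simp
  have hrβ : r ≫ β = J.map (biprod.fst ≫ g) := by
    simp [r, hk, hαβ.zero]
  have hr : J.map (biprod.lift i (-t)) ≫ r = 0 := by
    simp only [r, Preadditive.comp_add, ← J.map_comp_assoc]
    simp [ht']
  -- A map killing `r` kills `X`, so it factors through `β`; the factor is killed by the epimorphism
  -- `J.map g`.
  have : Epi r := by
    refine Preadditive.epi_of_cancel_zero _ fun {T} z hz => ?_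
    have h₁ : k ≫ z = 0 := by rw [← hr₁, Category.assoc, hz, comp_zero]
    have h₂ : α ≫ z = 0 := by rw [← hr₂, Category.assoc, hz, comp_zero]
    obtain ⟨z', rfl⟩ := hαβ.exists_desc z h₂
    rw [← Category.assoc, hk] at h₁
    rw [(cancel_epi (J.map g)).1 (h₁.trans comp_zero.symm), comp_zero]
  have hlim : IsLimit (KernelFork.ofι _ hr) := by
    refine KernelFork.IsLimit.ofι' _ _ fun {T} x hx => Nonempty.some ?_
    have h₁ : (x ≫ J.map biprod.fst) ≫ J.map g = 0 := by
      rw [Category.assoc, ← J.map_comp, ← hrβ, reassoc_of% hx, zero_comp]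
    obtain ⟨y, hy⟩ := hJig.exists_lift _ h₁
    refine ⟨y, ?_⟩
    have h₂ : x ≫ J.map biprod.snd = - (y ≫ J.map t) := by
      rw [← cancel_mono α, Preadditive.neg_comp, Category.assoc, Category.assoc, ht',
        reassoc_of% hy, eq_neg_iff_add_eq_zero, add_comm, ← hx]
      simp [r]
    have h₃ : 𝟙 (J.obj (W ⊞ X)) =
        J.map biprod.fst ≫ J.map biprod.inl + J.map biprod.snd ≫ J.map biprod.inr := by
      rw [← J.map_comp, ← J.map_comp, ← J.map_add, biprod.total, J.map_id]
    rw [← Category.comp_id x, h₃, Preadditive.comp_add, ← Category.assoc x, ← Category.assoc x,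
      h₂, ← hy, Category.assoc, Preadditive.neg_comp, Category.assoc, ← sub_eq_add_neg,
      ← Preadditive.comp_sub, ← J.map_comp, ← J.map_comp, ← J.map_sub]
    congr 2
    ext <;> simp
  have hcol := (ExactStructure.ofAbelian_conflation_of_isLimit hr hlim).2.2.some
  let e : J.obj Z ≅ M := hJq.2.2.some.coconePointUniqueUpToIso hcol
  have he : J.map q ≫ e.hom = r :=
    hJq.2.2.some.comp_coconePointUniqueUpToIso_hom hcol WalkingParallelPair.one
  obtain ⟨p, hp⟩ := hq.exists_desc (biprod.fst ≫ g) (by simp [hig.zero])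
  have : Epi (J.map q) := hJq.epi
  have h₁ : J.map (biprod.inr ≫ q) ≫ e.hom = α := by rw [J.map_comp, Category.assoc, he, hr₂]
  have h₂ : e.hom ≫ β = J.map p := by
    rw [← cancel_epi (J.map q), ← Category.assoc, he, hrβ, ← hp, J.map_comp]
  refine ⟨Z, biprod.inr ≫ q, p, e, (h.fullyExact.conflation_iff _ _).2 ?_, h₁, h₂⟩
  have h₀ : J.map (biprod.inr ≫ q) ≫ J.map p = 0 := by
    rw [← h₂, reassoc_of% h₁, hαβ.zero]
  have : Epi (J.map p) := by rw [← h₂]; infer_instance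
  have : Mono (J.map (biprod.inr ≫ q)) := by
    have : Mono (J.map (biprod.inr ≫ q) ≫ e.hom) := by rw [h₁]; infer_instance
    exact mono_of_mono _ e.hom
  refine ExactStructure.ofAbelian_conflation_of_isLimit h₀
    (KernelFork.IsLimit.ofι' _ _ fun {T} x hx => Nonempty.some ?_)
  obtain ⟨y, hy⟩ := hαβ.exists_lift (x ≫ e.hom) (by rw [Category.assoc, h₂, hx])
  exact ⟨y, by rw [← cancel_mono e.hom, Category.assoc, h₁, hy]⟩

end IsCocompletion

section Sheaves

open Opposite

namespace ExactStructure

/-! ### Additive presheaves of abelian groups -/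

section Presheaf

lemma map_op_comp_apply {C : Type u} [Category.{v} C] (M : Cᵒᵖ ⥤ AddCommGrpCat.{w})
    {X Y Z : C} (f : X ⟶ Y) (g : Y ⟶ Z)
    (z : M.obj (op Z)) : M.map (f ≫ g).op z = M.map f.op (M.map g.op z) := by
  rw [op_comp, M.map_comp]
  rfl

variable {C : Type u} [Category.{v} C] [Preadditive C]

lemma map_op_sub_apply (M : Cᵒᵖ ⥤ AddCommGrpCat.{w}) [M.Additive] {X Y : C} (f g : X ⟶ Y)
    (y : M.obj (op Y)) : M.map (f - g).op y = M.map f.op y - M.map g.op y := by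
  rw [op_sub, M.map_sub]
  rfl

lemma map_op_add_apply (M : Cᵒᵖ ⥤ AddCommGrpCat.{w}) [M.Additive] {X Y : C} (f g : X ⟶ Y)
    (y : M.obj (op Y)) : M.map (f + g).op y = M.map f.op y + M.map g.op y := by
  rw [op_add, M.map_add]
  rfl

lemma map_op_zero_apply (M : Cᵒᵖ ⥤ AddCommGrpCat.{w}) [M.Additive] {X Y : C}
    (y : M.obj (op Y)) : M.map (0 : X ⟶ Y).op y = 0 := by
  rw [op_zero, M.map_zero]
  rfl

lemma additive_of_isColimit {I : Type u₁} [Category.{v₁} I] {D : I ⥤ Cᵒᵖ ⥤ AddCommGrpCat.{w}}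
    {c : Cocone D} (hc : IsColimit c)
    [∀ X, PreservesColimit D ((evaluation _ AddCommGrpCat.{w}).obj X)]
    (hD : ∀ i, (D.obj i).Additive) : c.pt.Additive := by
  refine ⟨fun {X Y f g} => ?_⟩
  refine (isColimitOfPreserves ((evaluation _ AddCommGrpCat.{w}).obj X) hc).hom_ext fun i => ?_
  have := hD i
  have e (h : X ⟶ Y) :
      (c.ι.app i).app X ≫ c.pt.map h = (D.obj i).map h ≫ (c.ι.app i).app Y :=
    ((c.ι.app i).naturality h).symm
  change (c.ι.app i).app X ≫ c.pt.map _ = (c.ι.app i).app X ≫ (c.pt.map f + c.pt.map g)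
  rw [Preadditive.comp_add, e, e, e, (D.obj i).map_add, Preadditive.add_comp]

lemma additive_of_isLimit {I : Type u₁} [Category.{v₁} I] {D : I ⥤ Cᵒᵖ ⥤ AddCommGrpCat.{w}}
    {c : Cone D} (hc : IsLimit c)
    [∀ X, PreservesLimit D ((evaluation _ AddCommGrpCat.{w}).obj X)]
    (hD : ∀ i, (D.obj i).Additive) : c.pt.Additive := by
  refine ⟨fun {X Y f g} => ?_⟩
  refine (isLimitOfPreserves ((evaluation _ AddCommGrpCat.{w}).obj Y) hc).hom_ext fun i => ?_
  have := hD i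
  change _ ≫ (c.π.app i).app Y = _ ≫ (c.π.app i).app Y
  rw [Preadditive.add_comp, NatTrans.naturality, NatTrans.naturality, NatTrans.naturality,
    (D.obj i).map_add, Preadditive.comp_add]

/-- The functor sending `Z` to the presheaf of abelian groups `X ↦ (H.obj X ⟶ Z)`. -/
@[simps]
def homPresheaf {C : Type u} [Category.{v} C] {B : Type u₁} [Category.{w} B] [Preadditive B]
    (H : C ⥤ B) : B ⥤ Cᵒᵖ ⥤ AddCommGrpCat.{w} where
  obj Z :=
    { obj X := AddCommGrpCat.of (H.obj X.unop ⟶ Z)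
      map f := AddCommGrpCat.ofHom (Preadditive.leftComp Z (H.map f.unop))
      map_id X := by
        ext k
        exact (congrArg (· ≫ k) (H.map_id X.unop)).trans (Category.id_comp k)
      map_comp f g := by
        ext k
        exact (congrArg (· ≫ k) (H.map_comp g.unop f.unop)).trans (Category.assoc _ _ k) }
  map φ :=
    { app X := AddCommGrpCat.ofHom (Preadditive.rightComp (H.obj X.unop) φ)
      naturality X Y f := by
        ext k
        exact Category.assoc (H.map f.unop) k φ }
  map_id Z := by
    ext X k
    exact Category.comp_id (X := H.obj X.unop) k
  map_comp f g := by
    ext X k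
    exact (Category.assoc (W := H.obj X.unop) k f g).symm

end Presheaf

/-! ### The topology of deflations: sheaves are left exact presheaves -/

section Topology

variable {C : Type w} [Category.{w} C] [Preadditive C] [HasZeroObject C] [HasBinaryBiproducts C]
  (E : ExactStructure C)

/-- The Grothendieck topology in which a sieve is covering if it contains a deflation. -/
def topology : GrothendieckTopology C where
  sieves X := {S | ∃ (Y : C) (g : Y ⟶ X), E.deflation g ∧ S g}
  top_mem' X := ⟨X, 𝟙 X, E.deflation_of_isIso _, trivial⟩
  pullback_stable' := by
    rintro X Y S f ⟨Z, g, hg, hS⟩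
    obtain ⟨W, a, b, sq, hb⟩ := E.base_change g f hg
    refine ⟨W, b, hb, ?_⟩
    change S (b ≫ f)
    rw [← sq.w]
    exact S.downward_closed hS a
  transitive' := by
    rintro X S ⟨Y, g, hg, hS⟩ R hR
    obtain ⟨W, k, hk, hkR⟩ := hR hS
    exact ⟨W, k ≫ g, E.deflation_comp _ _ hk hg, hkR⟩

/-- A presheaf of abelian groups is left exact on conflations if it sends conflations
`X ⟶ Y ⟶ Z` to exact sequences `0 ⟶ M Z ⟶ M Y ⟶ M X`. -/
structure IsLeftExactOn (M : Cᵒᵖ ⥤ AddCommGrpCat.{w}) : Prop where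
  eq_zero : ∀ ⦃Y Z : C⦄ (g : Y ⟶ Z), E.deflation g → ∀ z : M.obj (op Z), M.map g.op z = 0 → z = 0
  exists_eq : ∀ ⦃X Y Z : C⦄ (f : X ⟶ Y) (g : Y ⟶ Z), E.Conflation f g → ∀ y : M.obj (op Y),
    M.map f.op y = 0 → ∃ z : M.obj (op Z), M.map g.op z = y

variable {E}

lemma IsLeftExactOn.injective {M : Cᵒᵖ ⥤ AddCommGrpCat.{w}} (hM : E.IsLeftExactOn M) {Y Z : C}
    {g : Y ⟶ Z} (hg : E.deflation g) : Function.Injective (M.map g.op) :=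
  (injective_iff_map_eq_zero (M.map g.op).hom).2 (hM.eq_zero g hg)

/-- A matching family is determined by its value at one deflation `g` of the sieve. Comparing the
kernel `k` of `g` with `0` shows that this value restricts to zero along `k`, so it descends. The
other members of the sieve are checked after a base change of `g`. -/
lemma isSheaf_of_isLeftExactOn {M : Cᵒᵖ ⥤ AddCommGrpCat.{w}} [M.Additive]
    (hM : E.IsLeftExactOn M) : Presheaf.IsSheaf E.topology M := by
  rw [Presheaf.isSheaf_iff_isSheaf_forget (s := forget AddCommGrpCat.{w}),
    isSheaf_iff_isSheaf_of_type]
  rintro X S ⟨Y, g, hg, hS⟩ x hx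
  obtain ⟨K, k, hk⟩ := exists_conflation_of_deflation hg
  obtain ⟨z, hz⟩ := hM.exists_eq k g hk (x g hS) (by
    have h := hx k (0 : K ⟶ Y) hS hS (by simp [hk.zero])
    change M.map k.op (x g hS) = M.map (0 : K ⟶ Y).op (x g hS) at h
    rw [h, map_op_zero_apply])
  refine ⟨z, fun W f hf => ?_, fun z' hz' => hM.injective hg ((hz' g hS).trans hz.symm)⟩
  obtain ⟨V, a, b, sq, hb⟩ := E.base_change g f hg
  apply hM.injective hb
  have h := hx a b hS hf sq.w
  change M.map a.op (x g hS) = M.map b.op (x f hf) at h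
  change M.map b.op (M.map f.op z) = M.map b.op (x f hf)
  rw [← map_op_comp_apply, ← sq.w, map_op_comp_apply, hz, h]

lemma isLeftExactOn_of_isSheaf {M : Cᵒᵖ ⥤ AddCommGrpCat.{w}} [M.Additive]
    (hM : Presheaf.IsSheaf E.topology M) : E.IsLeftExactOn M := by
  rw [Presheaf.isSheaf_iff_isSheaf_forget (s := forget AddCommGrpCat.{w}),
    isSheaf_iff_isSheaf_of_type] at hM
  have hM' {Y Z : C} {g : Y ⟶ Z} (hg : E.deflation g) :
      Presieve.IsSheafFor (M ⋙ forget AddCommGrpCat.{w}) (Presieve.singleton g) := by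
    rw [Presieve.isSheafFor_iff_generate]
    exact hM _ ⟨Y, g, hg, Sieve.le_generate _ _ _ (Presieve.singleton_self g)⟩
  constructor
  · intro Y Z g hg z hz
    refine (hM' hg).isSeparatedFor.ext ?_
    rintro W f ⟨⟩
    exact hz.trans (map_zero (M.map g.op).hom).symm
  · intro X Y Z f g h y hy
    have := hM' h.deflation
    rw [Presieve.isSheafFor_singleton] at this
    obtain ⟨z, hz, -⟩ := this y (by
      intro W p₁ p₂ hp
      -- Two maps equalised by `g` differ by a map through its kernel, on which `y` vanishes.
      obtain ⟨l, hl⟩ := h.exists_lift (p₁ - p₂) (by simp [hp])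
      change M.map p₁.op y = M.map p₂.op y
      rw [← sub_eq_zero, ← map_op_sub_apply, ← hl, map_op_comp_apply, hy]
      exact map_zero (M.map l.op).hom)
    exact ⟨z, hz⟩

end Topology

/-! ### The abelian category of additive sheaves and its filtered colimits -/

section AdditiveSheaf

variable {C : Type w} [Category.{w} C] [Preadditive C] [HasZeroObject C] [HasBinaryBiproducts C]
  (E : ExactStructure C)

/-- The additive sheaves of abelian groups for the topology of deflations. -/
def additiveSheaves : ObjectProperty (Sheaf E.topology AddCommGrpCat.{w}) :=
  fun M => M.obj.Additive

/-- Additivity may be tested after a deflation. A section `s` comes from `M` over some deflation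
`p`; base changing `p` along `f` and then along `g` gives one deflation over which both pullbacks of
`s` come from `M`. -/
lemma additive_sheafify (M : Cᵒᵖ ⥤ AddCommGrpCat.{w}) [M.Additive] :
    (sheafify E.topology M).Additive := by
  have hs := (presheafToSheaf E.topology AddCommGrpCat.{w}).obj M |>.property
  rw [Presheaf.isSheaf_iff_isSheaf_forget (s := forget AddCommGrpCat.{w}),
    isSheaf_iff_isSheaf_of_type] at hs
  have key {X Y : C} (f g : X ⟶ Y) (s : (sheafify E.topology M).obj (op Y)) :
      (sheafify E.topology M).map (f + g).op s =
        (sheafify E.topology M).map f.op s + (sheafify E.topology M).map g.op s := by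
    obtain ⟨Z, p, hp, m, hm⟩ := Presheaf.imageSieve_mem E.topology (toSheafify E.topology M) s
    obtain ⟨V, a, b, sq, hb⟩ := E.base_change p f hp
    obtain ⟨V', a', b', sq', hb'⟩ := E.base_change p (b ≫ g) hp
    have hd := E.deflation_comp _ _ hb' hb
    refine (hs _ ⟨V', _, hd, Sieve.le_generate _ _ _
      (Presieve.singleton_self _)⟩).isSeparatedFor.ext ?_
    rintro W _ ⟨U, l, _, ⟨⟩, rfl⟩
    have e {T : C} (k : T ⟶ Z) : (sheafify E.topology M).map (k ≫ p).op s =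
        (toSheafify E.topology M).app _ (M.map k.op m) := by
      rw [map_op_comp_apply]
      refine (congrArg _ hm.symm).trans ?_
      exact (NatTrans.naturality_apply (toSheafify E.topology M) k.op m).symm
    have h₁ : (l ≫ b' ≫ b) ≫ f = (l ≫ b' ≫ a) ≫ p := by simp [sq.w]
    have h₂ : (l ≫ b' ≫ b) ≫ g = (l ≫ a') ≫ p := by simp [sq'.w]
    change (sheafify E.topology M).map (l ≫ b' ≫ b).op _ =
      (sheafify E.topology M).map (l ≫ b' ≫ b).op _
    refine Eq.trans ?_ (map_add ((sheafify E.topology M).map (l ≫ b' ≫ b).op).hom _ _).symm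
    change _ = (sheafify E.topology M).map (l ≫ b' ≫ b).op _ +
      (sheafify E.topology M).map (l ≫ b' ≫ b).op _
    rw [← map_op_comp_apply, ← map_op_comp_apply, ← map_op_comp_apply, Preadditive.comp_add,
      h₁, h₂, ← Preadditive.add_comp, e, e, e, map_op_add_apply]
    exact map_add ((toSheafify E.topology M).app _).hom _ _
  refine ⟨fun {X Y f g} => ?_⟩
  ext s
  exact key f.unop g.unop s

instance : E.additiveSheaves.IsClosedUnderIsomorphisms where
  of_iso {M N} e h := by
    have : M.obj.Additive := h
    let e' : M.obj ≅ N.obj := (sheafToPresheaf _ _).mapIso e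
    exact Functor.additive_of_iso e'

instance (I : Type u₁) [Category.{v₁} I] [HasColimitsOfShape I AddCommGrpCat.{w}] :
    E.additiveSheaves.IsClosedUnderColimitsOfShape I := by
  refine .mk' ?_
  rintro _ ⟨D, hD⟩
  have : (colimit (D ⋙ sheafToPresheaf _ _)).Additive :=
    additive_of_isColimit (colimit.isColimit _) hD
  refine E.additiveSheaves.prop_of_iso ((Sheaf.isColimitSheafifyCocone _
    (colimit.isColimit (D ⋙ sheafToPresheaf _ _))).coconePointUniqueUpToIso
      (colimit.isColimit D)) ?_
  exact E.additive_sheafify (colimit (D ⋙ sheafToPresheaf _ _))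

instance (I : Type u₁) [Category.{v₁} I] [HasLimitsOfShape I AddCommGrpCat.{w}] :
    E.additiveSheaves.IsClosedUnderLimitsOfShape I := by
  refine .mk' ?_
  rintro _ ⟨D, hD⟩
  exact additive_of_isLimit (isLimitOfPreserves (sheafToPresheaf _ _) (limit.isLimit D)) hD

/-- The category of additive sheaves. -/
abbrev AdditiveSheaf := E.additiveSheaves.FullSubcategory

instance : E.additiveSheaves.IsClosedUnderFiniteProducts where

instance : E.additiveSheaves.IsClosedUnderKernels where
  kernels_le := by
    rintro _ ⟨f, k, hk, hf⟩
    refine E.additiveSheaves.prop_of_isLimit hk ?_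
    rintro (_ | _)
    exacts [hf.1, hf.2]

instance : E.additiveSheaves.IsClosedUnderCokernels where
  cokernels_le := by
    rintro _ ⟨f, k, hk, hf⟩
    refine E.additiveSheaves.prop_of_isColimit hk ?_
    rintro (_ | _)
    exacts [hf.1, hf.2]

instance : E.additiveSheaves.ContainsZero where
  exists_zero := ⟨_, isZero_zero _,
    E.additiveSheaves.prop_of_isTerminal _ (isZero_zero _).isTerminal⟩

noncomputable instance : Abelian E.AdditiveSheaf := inferInstance

instance : HasColimitsOfSize.{w, w} E.AdditiveSheaf where
  has_colimits_of_shape I _ := hasColimitsOfShape_of_closedUnderColimits I _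

/-- The underlying presheaf of an additive sheaf. -/
abbrev toPresheaf : E.AdditiveSheaf ⥤ Cᵒᵖ ⥤ AddCommGrpCat.{w} :=
  E.additiveSheaves.ι ⋙ sheafToPresheaf _ _

instance (M : E.AdditiveSheaf) : M.obj.obj.Additive := M.property

lemma isLeftExactOn (M : E.AdditiveSheaf) : E.IsLeftExactOn M.obj.obj :=
  isLeftExactOn_of_isSheaf M.obj.property

variable {E}

/-- The additive sheaf given by a left exact additive presheaf. -/
@[simps]
def AdditiveSheaf.mk (M : Cᵒᵖ ⥤ AddCommGrpCat.{w}) (hM : M.Additive) (hM' : E.IsLeftExactOn M) :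
    E.AdditiveSheaf :=
  ⟨⟨M, isSheaf_of_isLeftExactOn hM'⟩, hM⟩

/-- Each condition involves finitely many sections and equations, hence already holds at some stage
of the filtered diagram. Filtered colimits of additive sheaves therefore need no sheafification. -/
lemma isLeftExactOn_of_isColimit {I : Type w} [SmallCategory I] [IsFiltered I]
    {D : I ⥤ Cᵒᵖ ⥤ AddCommGrpCat.{w}} {c : Cocone D} (hc : IsColimit c)
    (hD : ∀ i, E.IsLeftExactOn (D.obj i)) : E.IsLeftExactOn c.pt := by
  have hc' (X : Cᵒᵖ) := isColimitOfPreserves ((evaluation _ AddCommGrpCat.{w}).obj X) hc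
  have nat {X Y : C} (f : X ⟶ Y) (i : I) (y : (D.obj i).obj (op Y)) :
      c.pt.map f.op ((c.ι.app i).app (op Y) y) =
        (c.ι.app i).app (op X) ((D.obj i).map f.op y) :=
    (NatTrans.naturality_apply (c.ι.app i) f.op y).symm
  have rep {X : C} (x : c.pt.obj (op X)) :
      ∃ (i : I) (y : (D.obj i).obj (op X)), (c.ι.app i).app (op X) y = x :=
    Concrete.isColimit_exists_rep _ (hc' (op X)) x
  have eq_zero {X : C} {i : I} (x : (D.obj i).obj (op X))
      (hx : (c.ι.app i).app (op X) x = 0) :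
      ∃ (j : I) (u : i ⟶ j), (D.map u).app (op X) x = 0 := by
    obtain ⟨j, u, v, h⟩ := Concrete.isColimit_exists_of_rep_eq _ (hc' (op X)) x
      (0 : (D.obj i).obj (op X)) (hx.trans (map_zero ((c.ι.app i).app (op X)).hom).symm)
    exact ⟨j, u, h.trans (map_zero ((D.map v).app (op X)).hom)⟩
  have w' {X : C} {i j : I} (u : i ⟶ j) (x : (D.obj i).obj (op X)) :
      (c.ι.app j).app (op X) ((D.map u).app (op X) x) = (c.ι.app i).app (op X) x :=
    ConcreteCategory.congr_hom (NatTrans.congr_app (c.w u) (op X)) x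
  constructor
  · intro Y Z g hg z hz
    obtain ⟨i, z, rfl⟩ := rep z
    rw [nat] at hz
    obtain ⟨j, u, hu⟩ := eq_zero _ hz
    rw [NatTrans.naturality_apply] at hu
    rw [← w' u, (hD j).eq_zero g hg _ hu]
    exact map_zero ((c.ι.app j).app (op Z)).hom
  · intro X Y Z f g h y hy
    obtain ⟨i, y, rfl⟩ := rep y
    rw [nat] at hy
    obtain ⟨j, u, hu⟩ := eq_zero _ hy
    rw [NatTrans.naturality_apply] at hu
    obtain ⟨z, hz⟩ := (hD j).exists_eq f g h _ hu
    refine ⟨(c.ι.app j).app (op Z) z, ?_⟩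
    rw [nat, hz, w']

instance {I : Type w} [SmallCategory I] [IsFiltered I] :
    PreservesColimitsOfShape I E.toPresheaf where
  preservesColimit {D} := by
    let M : E.AdditiveSheaf := .mk (colimit (D ⋙ E.toPresheaf))
      (additive_of_isColimit (colimit.isColimit _) fun i => (D.obj i).property)
      (isLeftExactOn_of_isColimit (colimit.isColimit _) fun i => E.isLeftExactOn (D.obj i))
    have : CreatesColimit D E.toPresheaf :=
      createsColimitOfFullyFaithfulOfIso M (Iso.refl (colimit (D ⋙ E.toPresheaf)))
    exact preservesColimit_of_createsColimit_and_hasColimit _ _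

section homSheaf

variable {B : Type u₁} [Category.{w} B] [Preadditive B] {H : C ⥤ B}

lemma additive_homPresheaf_obj (hH : E.IsRightExactOn H) (Z : B) :
    ((homPresheaf H).obj Z).Additive := by
  have := hH.additive
  refine ⟨fun {X Y f g} => ?_⟩
  ext k
  change H.map (f.unop + g.unop) ≫ k = H.map f.unop ≫ k + H.map g.unop ≫ k
  exact (congrArg (· ≫ k) (H.map_add (f := f.unop) (g := g.unop))).trans
    (Preadditive.add_comp _ _ _ _ _ k)

lemma isLeftExactOn_homPresheaf_obj (hH : E.IsRightExactOn H) (Z : B) :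
    E.IsLeftExactOn ((homPresheaf H).obj Z) where
  eq_zero Y X g hg z hz := by
    have := hH.epi hg
    exact (cancel_epi (H.map g)).1 (hz.trans comp_zero.symm)
  exists_eq _ _ _ f g h y hy := hH.exists_desc h y hy

/-- The functor sending `Z` to the additive sheaf `X ↦ (H.obj X ⟶ Z)`, where `H` is right exact
on conflations. -/
def homSheaf (hH : E.IsRightExactOn H) : B ⥤ E.AdditiveSheaf :=
  ObjectProperty.lift _ (ObjectProperty.lift _ (homPresheaf H) fun Z =>
    have := additive_homPresheaf_obj hH Z
    isSheaf_of_isLeftExactOn (isLeftExactOn_homPresheaf_obj hH Z)) (additive_homPresheaf_obj hH)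

end homSheaf

variable (E)

/-- The Yoneda embedding of an exact category into its category of additive sheaves. -/
def yonedaSheaf : C ⥤ E.AdditiveSheaf := homSheaf (H := 𝟭 C) isRightExactOn_id

variable {E}

/-- Morphisms from a representable additive sheaf. -/
def yonedaSheafEquiv {X : C} {M : E.AdditiveSheaf} :
    (E.yonedaSheaf.obj X ⟶ M) ≃ M.obj.obj.obj (op X) where
  toFun φ := φ.hom.hom.app (op X) (𝟙 X)
  invFun m := ⟨⟨
    { app Y := AddCommGrpCat.ofHom
        (AddMonoidHom.mk' (fun f : Y.unop ⟶ X => M.obj.obj.map f.op m)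
          fun f g => map_op_add_apply M.obj.obj f g m)
      naturality Y Z f := by
        ext k
        exact map_op_comp_apply M.obj.obj f.unop k m }⟩⟩
  left_inv φ := by
    ext Y f
    exact (NatTrans.naturality_apply φ.hom.hom (Quiver.Hom.op f) (𝟙 X)).symm.trans
      (congrArg (φ.hom.hom.app Y) (Category.comp_id (X := Y.unop) (Y := X) f))
  right_inv m := by
    change M.obj.obj.map (𝟙 X).op m = m
    simp

lemma yonedaSheafEquiv_comp {X : C} {M N : E.AdditiveSheaf} (φ : E.yonedaSheaf.obj X ⟶ M)
    (ψ : M ⟶ N) : yonedaSheafEquiv (φ ≫ ψ) = ψ.hom.hom.app (op X) (yonedaSheafEquiv φ) := rfl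

lemma yonedaSheafEquiv_naturality {X Y : C} {M : E.AdditiveSheaf} (f : Y ⟶ X)
    (φ : E.yonedaSheaf.obj X ⟶ M) :
    yonedaSheafEquiv (E.yonedaSheaf.map f ≫ φ) = M.obj.obj.map f.op (yonedaSheafEquiv φ) := by
  refine Eq.trans ?_ (NatTrans.naturality_apply φ.hom.hom f.op (𝟙 X))
  exact congrArg (φ.hom.hom.app (op Y)) ((Category.id_comp f).trans (Category.comp_id f).symm)

end AdditiveSheaf

end ExactStructure

/-! ### Generation by `J` and density of `J` -/

namespace IsCocompletion

open ExactStructure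

section General

variable {A : Type u} [Category.{v} A] [Preadditive A] [HasZeroObject A] [HasBinaryBiproducts A]
  {B : Type u₁} [Category.{w} B] [Abelian B] {E : ExactStructure A} {J : A ⥤ B}

/-- This passes from detecting nonzero objects to detecting nonzero morphisms: a nonzero map into
the image of `f` lifts to `Y` after a deflation. -/
lemma eq_zero (h : IsCocompletion E J) {Y T : B} (f : Y ⟶ T)
    (hf : ∀ (X : A) (g : J.obj X ⟶ Y), g ≫ f = 0) : f = 0 := by
  by_contra hne
  have hI : ¬ IsZero (Abelian.image f) := fun hI => hne (by
    rw [← Abelian.image.fac f, hI.eq_zero_of_src (Abelian.image.ι f), comp_zero])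
  obtain ⟨X, g, hg⟩ := h.exists_ne_zero _ hI
  obtain ⟨W, p, k, hp, hk⟩ := h.exists_lift X (Abelian.factorThruImage f) g
  have := h.isRightExactOn.epi hp
  refine hg ?_
  rw [← cancel_epi (J.map p), ← cancel_mono (Abelian.image.ι f), ← hk, Category.assoc,
    Abelian.image.fac, hf]
  simp

lemma hom_ext (h : IsCocompletion E J) {Y T : B} {f f' : Y ⟶ T}
    (hf : ∀ (X : A) (g : J.obj X ⟶ Y), g ≫ f = g ≫ f') : f = f' := by
  rw [← sub_eq_zero]
  exact h.eq_zero _ fun X g => by rw [Preadditive.comp_sub, hf, sub_self]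

/-- A coproduct is the filtered colimit of its finite subsums, so `u` factors through one of them by
finite presentation. Finite subsums come from biproducts in `A`, and fullness brings the
factorisation back to `A`. -/
lemma exists_fac (h : IsCocompletion E J) [HasFiniteBiproducts A] {ι : Type w} (X : ι → A)
    [HasCoproduct fun i => J.obj (X i)] {Y : A} (u : J.obj Y ⟶ ∐ fun i => J.obj (X i)) :
    ∃ (n : Type w) (_ : Fintype n) (k : n → ι) (s : Y ⟶ ⨁ fun a => X (k a)),
      u = J.map s ≫ ∑ a, J.map (biproduct.π _ a) ≫ Sigma.ι (fun i => J.obj (X i)) (k a) := by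
  have := h.fullyExact.full
  have := h.isRightExactOn.additive
  have := h.cocomplete
  have := h.finitelyPresented Y
  obtain ⟨S, p, hp⟩ := IsFinitelyPresentable.exists_hom_of_isColimit
    (CoproductsFromFiniteFiltered.isColimitFiniteSubproductsCocone fun i => J.obj (X i)) u
  classical
  let e : (∐ fun x : S => J.obj (X x.1.as)) ⟶ J.obj (⨁ fun x : S => X x.1.as) :=
    Sigma.desc fun x => J.map (biproduct.ι (fun x : S => X x.1.as) x)
  have he : e ≫ (∑ x : S, J.map (biproduct.π (fun x : S => X x.1.as) x) ≫
      Sigma.ι (fun i => J.obj (X i)) x.1.as) =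
        Sigma.desc fun x : S => Sigma.ι (fun i => J.obj (X i)) x.1.as := by
    refine Sigma.hom_ext _ _ fun x => ?_
    rw [Sigma.ι_desc, Sigma.ι_desc_assoc, Preadditive.comp_sum, Finset.sum_eq_single x]
    · rw [← J.map_comp_assoc, biproduct.ι_π_self, J.map_id, Category.id_comp]
    · intro y _ hy
      rw [← J.map_comp_assoc, biproduct.ι_π_ne _ hy.symm, J.map_zero, zero_comp]
    · simp
  obtain ⟨s, hs⟩ := J.map_surjective (p ≫ e)
  refine ⟨S, inferInstance, fun x => x.1.as, s, ?_⟩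
  rw [hs]
  exact hp.symm.trans ((congrArg (fun t => p ≫ t) he.symm).trans (Category.assoc p e _).symm)

end General

section Small

variable {C : Type w} [Category.{w} C] [Preadditive C] [HasZeroObject C] [HasBinaryBiproducts C]
  {B : Type u₁} [Category.{w} B] [Abelian B] {E : ExactStructure C} {J : C ⥤ B}

lemma epi_sigma_desc (h : IsCocompletion E J) (Y : B)
    [HasCoproduct fun i : Σ X : C, (J.obj X ⟶ Y) => J.obj i.1] :
    Epi (Sigma.desc fun i : Σ X : C, (J.obj X ⟶ Y) => i.2) := by
  refine Preadditive.epi_of_cancel_zero _ fun {T} z hz => h.eq_zero z fun X g => ?_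
  have := Sigma.ι (fun i : Σ X : C, (J.obj X ⟶ Y) => J.obj i.1) ⟨X, g⟩ ≫= hz
  simpa using this

theorem generatedByDirectSums (h : IsCocompletion E J) : GeneratedByDirectSums J := by
  have := h.cocomplete
  intro Y
  exact ⟨Σ X : C, (J.obj X ⟶ Y), fun i => i.1, inferInstance, _, h.epi_sigma_desc Y⟩

/-- Take the canonical epimorphism `p` from the sum of all `J X ⟶ Y` and the map `q` defined by `φ`
on the same sum. It suffices that `q` kills the kernel of `p`, which is tested on objects `J X`,
hence on finite subsums. -/
lemma exists_hom_of_naturality (h : IsCocompletion E J) {Y T : B}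
    (φ : ∀ X : C, (J.obj X ⟶ Y) → (J.obj X ⟶ T))
    (hφ : ∀ (X' X : C) (a : X' ⟶ X) (g : J.obj X ⟶ Y), φ X' (J.map a ≫ g) = J.map a ≫ φ X g) :
    ∃ m : Y ⟶ T, ∀ (X : C) (g : J.obj X ⟶ Y), g ≫ m = φ X g := by
  have := h.isRightExactOn.additive
  have := h.cocomplete
  have : HasFiniteProducts C := hasFiniteProducts_of_has_binary_and_terminal
  have : HasFiniteBiproducts C := HasFiniteBiproducts.of_hasFiniteProducts
  have := h.epi_sigma_desc Y
  let p := Sigma.desc fun i : Σ X : C, (J.obj X ⟶ Y) => i.2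
  let q := Sigma.desc fun i : Σ X : C, (J.obj X ⟶ Y) => φ i.1 i.2
  have hφ₀ (X : C) : φ X 0 = 0 := by
    have := hφ X X 0 0
    rwa [J.map_zero, zero_comp, zero_comp] at this
  have hpq : kernel.ι p ≫ q = 0 := by
    refine h.eq_zero _ fun X g => ?_
    obtain ⟨n, _, k, s, hs⟩ := h.exists_fac (fun i : Σ X : C, (J.obj X ⟶ Y) => i.1)
      (g ≫ kernel.ι p)
    have hs₀ : (g ≫ kernel.ι p) ≫ p = 0 := by simp
    set r := ∑ a, J.map (biproduct.π _ a) ≫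
      Sigma.ι (fun i : Σ X : C, (J.obj X ⟶ Y) => J.obj i.1) (k a) with hr
    classical
    have hι (a : n) : J.map (biproduct.ι _ a) ≫ r =
        Sigma.ι (fun i : Σ X : C, (J.obj X ⟶ Y) => J.obj i.1) (k a) := by
      rw [hr, Preadditive.comp_sum, Finset.sum_eq_single a]
      · rw [← J.map_comp_assoc, biproduct.ι_π_self, J.map_id, Category.id_comp]
      · intro y _ hy
        rw [← J.map_comp_assoc, biproduct.ι_π_ne _ hy.symm, J.map_zero, zero_comp]
      · simp
    have hid : ∑ a, biproduct.π (fun a => (k a).1) a ≫ biproduct.ι (fun a => (k a).1) a =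
        𝟙 (⨁ fun a => (k a).1) := by
      refine biproduct.hom_ext' _ _ fun a => ?_
      rw [Preadditive.comp_sum, Finset.sum_eq_single a]
      · simp
      · intro y _ hy
        rw [← Category.assoc, biproduct.ι_π_ne _ hy.symm, zero_comp]
      · simp
    -- Decomposing the identity of the biproduct reduces this to the inclusions, where naturality
    -- applies; additivity of `φ` is not assumed.
    have hrq : r ≫ q = φ _ (r ≫ p) := by
      rw [← Category.id_comp (φ _ (r ≫ p)), ← J.map_id, ← hid, J.map_sum,
        Preadditive.sum_comp, Preadditive.sum_comp]
      refine Finset.sum_congr rfl fun a _ => ?_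
      rw [J.map_comp, Category.assoc, Category.assoc, ← hφ,
        ← Category.assoc (J.map (biproduct.ι _ a)), hι]
      simp [p, q]
    rw [← Category.assoc, hs, Category.assoc, hrq, ← hφ, ← Category.assoc, ← hs, hs₀, hφ₀]
  refine ⟨Abelian.epiDesc p q hpq, fun X g => ?_⟩
  have h₁ : Sigma.ι (fun i : Σ X : C, (J.obj X ⟶ Y) => J.obj i.1) ⟨X, g⟩ ≫ p = g := by simp [p]
  conv_lhs => rw [← h₁]
  rw [Category.assoc, Abelian.comp_epiDesc]
  simp [q]

theorem isDense (h : IsCocompletion E J) : J.IsDense where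
  isDenseAt Y := by
    have key (s : Cocone (CostructuredArrow.proj J Y ⋙ J)) :
        ∃ m : Y ⟶ s.pt, ∀ (X : C) (g : J.obj X ⟶ Y),
          g ≫ m = s.ι.app (CostructuredArrow.mk g) :=
      h.exists_hom_of_naturality (fun X g => s.ι.app (CostructuredArrow.mk g)) fun X' X a g =>
        (s.w (CostructuredArrow.homMk a : CostructuredArrow.mk (J.map a ≫ g) ⟶
          CostructuredArrow.mk g)).symm
    choose m hm using key
    refine ⟨{ desc := m, fac := fun s j => ?_, uniq := fun s l hl => h.hom_ext fun X g => ?_ }⟩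
    · exact (congrArg (· ≫ m s) (Category.id_comp j.hom)).trans (hm s j.left j.hom)
    · exact ((congrArg (· ≫ l) (Category.id_comp g)).symm.trans
        (hl (CostructuredArrow.mk g))).trans (hm s X g).symm

end Small

end IsCocompletion

/-! ### Exactness of `Z ↦ Hom(H -, Z)` and epimorphisms of additive sheaves -/

namespace ExactStructure

section HomPresheaf

variable {C : Type u} [Category.{v} C] {B : Type u₁} [Category.{w} B] [Preadditive B]

/-- The sections of `homPresheaf H` over `X` are the morphisms out of `H.obj X`. -/
def homPresheafCompEvaluationCompForget (H : C ⥤ B) (X : Cᵒᵖ) :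
    (homPresheaf H ⋙ (evaluation _ _).obj X) ⋙ forget AddCommGrpCat.{w} ≅
      coyoneda.obj (op (H.obj X.unop)) :=
  NatIso.ofComponents (fun _ => Iso.refl _) fun _ => rfl

lemma preservesLimitsOfShape_homPresheaf (H : C ⥤ B) (I : Type u₂) [Category.{v₂} I]
    [HasLimitsOfShape I AddCommGrpCat.{w}]
    [PreservesLimitsOfShape I (forget AddCommGrpCat.{w})] :
    PreservesLimitsOfShape I (homPresheaf H) := by
  refine preservesLimitsOfShape_of_evaluation _ _ fun X => ?_
  have := reflectsLimitsOfShape_of_reflectsIsomorphisms (J := I) (G := forget AddCommGrpCat.{w})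
  have := preservesLimitsOfShape_of_natIso (J := I)
    (homPresheafCompEvaluationCompForget H X).symm
  exact preservesLimitsOfShape_of_reflects_of_preserves _ (forget AddCommGrpCat.{w})

lemma preservesFilteredColimits_homPresheaf (H : C ⥤ B)
    (hH : ∀ X, IsFinitelyPresentable.{w} (H.obj X)) (I : Type w) [SmallCategory I] [IsFiltered I] :
    PreservesColimitsOfShape I (homPresheaf H) := by
  refine preservesColimitsOfShape_of_evaluation _ _ fun X => ?_
  have := reflectsColimitsOfShape_of_reflectsIsomorphisms (J := I)
    (G := forget AddCommGrpCat.{w})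
  have := hH X.unop
  have := preservesColimitsOfShape_of_natIso (J := I)
    (homPresheafCompEvaluationCompForget H X).symm
  exact preservesColimitsOfShape_of_reflects_of_preserves _ (forget AddCommGrpCat.{w})

end HomPresheaf

section HomSheaf

variable {C : Type w} [Category.{w} C] [Preadditive C] [HasZeroObject C] [HasBinaryBiproducts C]
  {E : ExactStructure C} {B : Type u₁} [Category.{w} B] [Preadditive B] {H : C ⥤ B}

lemma preservesFiniteLimits_homSheaf (hH : E.IsRightExactOn H) :
    PreservesFiniteLimits (homSheaf hH) where
  preservesFiniteLimits I _ _ := by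
    have : PreservesLimitsOfShape I (homSheaf hH ⋙ E.toPresheaf) :=
      preservesLimitsOfShape_homPresheaf H I
    exact preservesLimitsOfShape_of_reflects_of_preserves _ E.toPresheaf

lemma preservesFilteredColimits_homSheaf (hH : E.IsRightExactOn H)
    (hH' : ∀ X, IsFinitelyPresentable.{w} (H.obj X)) (I : Type w) [SmallCategory I] [IsFiltered I] :
    PreservesColimitsOfShape I (homSheaf hH) := by
  have : PreservesColimitsOfShape I (homSheaf hH ⋙ E.toPresheaf) :=
    preservesFilteredColimits_homPresheaf H hH' I
  exact preservesColimitsOfShape_of_reflects_of_preserves _ E.toPresheaf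

instance (hH : E.IsRightExactOn H) : (homSheaf hH).Additive where
  map_add {Y Z f g} := by
    ext X k
    exact Preadditive.comp_add (C := B) _ _ _ k f g

/-- The inclusion into all sheaves preserves and reflects epimorphisms. Read through Yoneda, the
right-hand side is the lifting property (cc4). -/
lemma epi_iff_locally_surjective {M N : E.AdditiveSheaf} (φ : M ⟶ N) :
    Epi φ ↔ ∀ (X : C) (n : N.obj.obj.obj (op X)), ∃ (Y : C) (g : Y ⟶ X)
      (m : M.obj.obj.obj (op Y)), E.deflation g ∧ φ.hom.hom.app (op Y) m = N.obj.obj.map g.op n := by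
  have h₁ : Epi φ ↔ Epi φ.hom := by
    constructor
    · intro
      have := E.additiveSheaves.preservesEpimorphisms_ι_of_isNormalMonoCategory
      exact inferInstanceAs (Epi (E.additiveSheaves.ι.map φ))
    · intro (h : Epi (E.additiveSheaves.ι.map φ))
      exact E.additiveSheaves.ι.epi_of_epi_map h
  rw [h₁, ← Sheaf.isLocallySurjective_iff_epi']
  constructor
  · intro h X n
    obtain ⟨Y, g, hg, m, hm⟩ := Presheaf.imageSieve_mem E.topology φ.hom.hom n
    exact ⟨Y, g, m, hg, hm⟩
  · intro h
    refine ⟨fun {X} n => ?_⟩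
    obtain ⟨Y, g, m, hg, hm⟩ := h X n
    exact ⟨Y, g, hg, m, hm⟩

end HomSheaf

/-! ### The Yoneda embedding is a cocompletion -/

section Yoneda

variable {C : Type w} [Category.{w} C] [Preadditive C] [HasZeroObject C] [HasBinaryBiproducts C]
  (E : ExactStructure C)

instance : E.yonedaSheaf.Additive := inferInstanceAs (homSheaf _).Additive

instance : E.yonedaSheaf.Faithful where
  map_injective {X Y f g} h := by
    have := congrArg yonedaSheafEquiv h
    exact (Category.id_comp f).symm.trans (Eq.trans this (Category.id_comp g))

instance : E.yonedaSheaf.Full where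
  map_surjective {X Y} φ := by
    refine ⟨(yonedaSheafEquiv φ : X ⟶ Y), yonedaSheafEquiv.injective ?_⟩
    exact Category.id_comp (obj := C) _

lemma epi_yonedaSheaf_map_iff {X Y : C} (f : X ⟶ Y) :
    Epi (E.yonedaSheaf.map f) ↔ ∃ (W : C) (k : W ⟶ X), E.deflation (k ≫ f) := by
  rw [epi_iff_locally_surjective]
  constructor
  · intro h
    -- Local surjectivity at the universal section `𝟙 Y` suffices.
    obtain ⟨W, g, k, hg, hk⟩ := h Y (𝟙 Y)
    refine ⟨W, k, ?_⟩
    have hk : k ≫ f = g ≫ 𝟙 Y := hk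
    rwa [hk, Category.comp_id]
  · rintro ⟨W, k, hk⟩ Z n
    obtain ⟨V, a, b, sq, hb⟩ := E.base_change (k ≫ f) n hk
    exact ⟨V, b, a ≫ k, hb, (Category.assoc _ _ _).trans sq.w⟩

lemma yonedaSheaf_conflation_iff {X Y Z : C} (f : X ⟶ Y) (g : Y ⟶ Z) :
    E.Conflation f g ↔
      (ofAbelian E.AdditiveSheaf).Conflation (E.yonedaSheaf.map f) (E.yonedaSheaf.map g) := by
  constructor
  · intro h
    have : Epi (E.yonedaSheaf.map g) :=
      (E.epi_yonedaSheaf_map_iff g).2 ⟨Y, 𝟙 Y, by rw [Category.id_comp]; exact h.deflation⟩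
    have zero : E.yonedaSheaf.map f ≫ E.yonedaSheaf.map g = 0 := by
      rw [← E.yonedaSheaf.map_comp, h.zero, E.yonedaSheaf.map_zero]
    refine ofAbelian_conflation_of_isLimit zero ?_
    have : PreservesFiniteLimits E.yonedaSheaf := preservesFiniteLimits_homSheaf _
    exact isLimitForkMapOfIsLimit' E.yonedaSheaf _ h.nonempty_isLimit.some
  · intro h
    have : Epi (E.yonedaSheaf.map g) := h.epi
    have : Mono (E.yonedaSheaf.map f) := h.mono
    have : Mono f := E.yonedaSheaf.mono_of_mono_map this
    obtain ⟨W, k, hk⟩ := (E.epi_yonedaSheaf_map_iff g).1 h.epi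
    have zero : f ≫ g = 0 := E.yonedaSheaf.map_injective (by
      rw [E.yonedaSheaf.map_comp, h.zero, E.yonedaSheaf.map_zero])
    -- Here `g` is not yet known to be a deflation; only `k ≫ g` is.
    refine ⟨E.inflation_of_isLimit_of_deflation_comp hk zero
      (KernelFork.IsLimit.ofι' _ _ fun {T} x hx => Nonempty.some ?_), zero, ?_⟩
    · obtain ⟨l, hl⟩ := h.exists_lift (E.yonedaSheaf.map x) (by
        rw [← E.yonedaSheaf.map_comp, hx, E.yonedaSheaf.map_zero])
      obtain ⟨l, rfl⟩ := E.yonedaSheaf.map_surjective l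
      exact ⟨l, E.yonedaSheaf.map_injective (by rw [E.yonedaSheaf.map_comp, hl])⟩
    · have : Epi g := E.yonedaSheaf.epi_of_epi_map ‹_›
      refine ⟨CokernelCofork.IsColimit.ofπ' _ _ fun {T} x hx => Nonempty.some ?_⟩
      obtain ⟨l, hl⟩ := h.exists_desc (E.yonedaSheaf.map x) (by
        rw [← E.yonedaSheaf.map_comp, hx, E.yonedaSheaf.map_zero])
      obtain ⟨l, rfl⟩ := E.yonedaSheaf.map_surjective l
      exact ⟨l, E.yonedaSheaf.map_injective (by rw [E.yonedaSheaf.map_comp, hl])⟩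

/-- Morphisms out of a representable additive sheaf are sections. -/
def coyonedaObjYonedaSheafIso (X : C) :
    coyoneda.obj (op (E.yonedaSheaf.obj X)) ≅
      E.toPresheaf ⋙ (evaluation _ _).obj (op X) ⋙ forget AddCommGrpCat.{w} :=
  NatIso.ofComponents (fun _ => yonedaSheafEquiv.toIso) fun _ => rfl

theorem isCocompletion_yonedaSheaf : IsCocompletion E E.yonedaSheaf where
  cocomplete := inferInstance
  fullyExact := ⟨inferInstance, inferInstance, fun _ _ _ f g => E.yonedaSheaf_conflation_iff f g⟩
  finitelyPresented X := by
    rw [isFinitelyPresentable_iff_preservesFilteredColimitsOfSize]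
    exact ⟨fun I _ _ => preservesColimitsOfShape_of_natIso (E.coyonedaObjYonedaSheafIso X).symm⟩
  exists_ne_zero M hM := by
    by_contra! h
    refine hM ((IsZero.iff_id_eq_zero M).2 ?_)
    ext X m
    have := congrArg yonedaSheafEquiv (h X.unop (yonedaSheafEquiv.symm m))
    rw [Equiv.apply_symm_apply] at this
    exact this
  exists_lift X U V φ _ f := by
    obtain ⟨Y, g, m, hg, hm⟩ := (epi_iff_locally_surjective φ).1 ‹_› X (yonedaSheafEquiv f)
    refine ⟨Y, g, yonedaSheafEquiv.symm m, hg, yonedaSheafEquiv.injective ?_⟩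
    rw [yonedaSheafEquiv_comp, Equiv.apply_symm_apply, hm, yonedaSheafEquiv_naturality]

end Yoneda

end ExactStructure

/-! ### Comparison of a cocompletion with additive sheaves -/

namespace IsCocompletion

open ExactStructure

variable {C : Type w} [Category.{w} C] [Preadditive C] [HasZeroObject C] [HasBinaryBiproducts C]
  {B : Type u₁} [Category.{w} B] [Abelian B] {E : ExactStructure C} {J : C ⥤ B}

lemma faithful_homPresheaf (h : IsCocompletion E J) : (homPresheaf J).Faithful where
  map_injective hfg := h.hom_ext fun X g =>
    ConcreteCategory.congr_hom (NatTrans.congr_app hfg (op X)) g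

lemma full_homPresheaf (h : IsCocompletion E J) : (homPresheaf J).Full where
  map_surjective {Y T} φ := by
    obtain ⟨m, hm⟩ := h.exists_hom_of_naturality (Y := Y) (T := T)
      (fun X g => φ.app (op X) g) fun X' X a g => NatTrans.naturality_apply φ a.op g
    refine ⟨m, ?_⟩
    ext X g
    exact hm X.unop g

/-- Exactness of filtered colimits is inherited from presheaves along the fully faithful
`homPresheaf J`, which preserves finite limits and filtered colimits. The sum of all `J X` is a
separator; it exists because `C` is small. -/
theorem isGrothendieckAbelian (h : IsCocompletion E J) : IsGrothendieckAbelian.{w} B := by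
  have := h.cocomplete
  have : HasFilteredColimitsOfSize.{w, w} B := ⟨fun _ => inferInstance⟩
  have := h.faithful_homPresheaf
  have := h.full_homPresheaf
  have : PreservesFiniteLimits (homPresheaf J) :=
    ⟨fun I _ _ => preservesLimitsOfShape_homPresheaf J I⟩
  have : AB5OfSize.{w, w} B := ⟨fun I _ _ => by
    have := preservesFilteredColimits_homPresheaf J h.finitelyPresented I
    exact HasExactColimitsOfShape.domain_of_functor I (homPresheaf J)⟩
  have : HasSeparator B := ⟨∐ J.obj, (isSeparator_sigma _).2 fun Y T f g hfg =>
    h.hom_ext fun X k => hfg _ (ObjectProperty.ofObj_apply _ X) k⟩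
  exact { }

/-- Dévissage: every object is a cokernel of a map between sums of objects `J X`, and such sums are
filtered colimits of finite ones. -/
lemma prop_of_isClosedUnderColimits (h : IsCocompletion E J) (P : ObjectProperty B)
    [P.IsClosedUnderFiniteCoproducts] [P.IsClosedUnderCokernels]
    (hP : ∀ (I : Type w) [SmallCategory I] [IsFiltered I], P.IsClosedUnderColimitsOfShape I)
    (hJ : ∀ X, P (J.obj X)) (Y : B) : P Y := by
  have := h.cocomplete
  have hsum {ι : Type w} (X : ι → C) : P (∐ fun i => J.obj (X i)) := by
    have := hP (Finset (Discrete ι))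
    have hc := CoproductsFromFiniteFiltered.isColimitFiniteSubproductsCocone fun i => J.obj (X i)
    exact (P.prop_of_isColimit hc fun S => P.prop_coproduct fun i => hJ _ :)
  obtain ⟨ι, X, _, p, hp⟩ := h.generatedByDirectSums Y
  obtain ⟨ι', X', _, q, hq⟩ := h.generatedByDirectSums (kernel p)
  have hpq : IsColimit (CokernelCofork.ofπ (f := q ≫ kernel.ι p) p (by simp)) :=
    CokernelCofork.IsColimit.ofπ' _ _ fun k hk =>
      ⟨Abelian.epiDesc p k ((cancel_epi q).1 (by simpa using hk)), Abelian.comp_epiDesc _ _ _⟩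
  exact P.prop_of_isColimit_cokernelCofork hpq (hsum X') (hsum X)

lemma faithful_homSheaf (h : IsCocompletion E J) : (homSheaf h.isRightExactOn).Faithful :=
  have := h.faithful_homPresheaf
  have : (homSheaf h.isRightExactOn ⋙ E.toPresheaf).Faithful := this
  .of_comp _ E.toPresheaf

lemma full_homSheaf (h : IsCocompletion E J) : (homSheaf h.isRightExactOn).Full :=
  have := h.full_homPresheaf
  have : (homSheaf h.isRightExactOn ⋙ E.toPresheaf).Full := this
  .of_comp_faithful _ E.toPresheaf

lemma preservesEpimorphisms_homSheaf (h : IsCocompletion E J) :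
    (homSheaf h.isRightExactOn).PreservesEpimorphisms where
  preserves φ _ := (epi_iff_locally_surjective _).2 fun X f => by
    obtain ⟨Y, g, k, hg, hk⟩ := h.exists_lift X φ f
    exact ⟨Y, g, k, hg, hk⟩

lemma preservesFiniteColimits_homSheaf (h : IsCocompletion E J) :
    PreservesFiniteColimits (homSheaf h.isRightExactOn) := by
  have := preservesFiniteLimits_homSheaf h.isRightExactOn
  have := h.preservesEpimorphisms_homSheaf
  refine ((Functor.preservesFiniteColimits_tfae _).out 0 3).1 fun S hS => ?_
  have := hS.epi_g
  have hS' := ((Functor.preservesFiniteLimits_tfae (homSheaf h.isRightExactOn)).out 3 0).1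
    (preservesFiniteLimits_homSheaf h.isRightExactOn)
  exact ⟨(hS' S hS).1, inferInstance⟩

/-- The Yoneda embedding is the restriction of `homSheaf` to a cocompletion. -/
noncomputable def compHomSheafIso (h : IsCocompletion E J) :
    E.yonedaSheaf ≅ J ⋙ homSheaf h.isRightExactOn :=
  have := h.fullyExact.full
  have := h.fullyExact.faithful
  have := h.isRightExactOn.additive
  NatIso.ofComponents
    (fun X => E.toPresheaf.preimageIso (NatIso.ofComponents (fun Y =>
      (AddEquiv.mk' (Functor.FullyFaithful.ofFullyFaithful J).homEquiv
        fun f g => J.map_add).toAddCommGrpIso) fun {Y Z} f => by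
          ext k
          exact J.map_comp f.unop k)) fun {X Y} f => by
            apply E.toPresheaf.map_injective
            rw [Functor.map_comp, Functor.map_comp, Functor.preimageIso_hom,
              Functor.preimageIso_hom, Functor.map_preimage, Functor.map_preimage]
            ext Z k
            exact J.map_comp k f

/-- For essential surjectivity, dévissage is applied to the Yoneda cocompletion: the essential image
contains the representables and is closed under the required colimits, since the functor is full,
faithful and preserves them. -/
lemma isEquivalence_homSheaf (h : IsCocompletion E J) :
    (homSheaf h.isRightExactOn).IsEquivalence := by
  have := h.faithful_homSheaf
  have := h.full_homSheaf
  have := h.cocomplete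
  have := h.preservesFiniteColimits_homSheaf
  have : (homSheaf h.isRightExactOn).essImage.IsClosedUnderFiniteCoproducts :=
    ⟨fun I _ => inferInstance⟩
  have : (homSheaf h.isRightExactOn).essImage.IsClosedUnderCokernels := ⟨by
    rintro _ ⟨f, k, hk, hf⟩
    refine (homSheaf h.isRightExactOn).essImage.prop_of_isColimit hk ?_
    rintro (_ | _)
    exacts [hf.1, hf.2]⟩
  have : (homSheaf h.isRightExactOn).EssSurj := ⟨fun M => by
    refine E.isCocompletion_yonedaSheaf.prop_of_isClosedUnderColimits
      (homSheaf h.isRightExactOn).essImage ?_ ?_ M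
    · intro I _ _
      have := preservesFilteredColimits_homSheaf h.isRightExactOn h.finitelyPresented I
      infer_instance
    · intro X
      exact ⟨J.obj X, ⟨(h.compHomSheafIso.app X).symm⟩⟩⟩
  exact { }

/-! ### Extension of right exact functors along a cocompletion -/

section Extension

variable {B' : Type u₂} [Category.{w} B']

/-- By Yoneda the left adjoint is defined at the representable of `X`, with value `H X`. Its domain
of definition is closed under colimits, so dévissage gives all additive sheaves. -/
lemma isRightAdjoint_homSheaf [Preadditive B'] [HasColimitsOfSize.{w, w} B'] {H : C ⥤ B'}
    (hH : E.IsRightExactOn H) :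
    (homSheaf hH).IsRightAdjoint := by
  refine Functor.isRightAdjoint_of_leftAdjointObjIsDefined_eq_top ?_
  ext M
  simp only [Pi.top_apply, Prop.top_eq_true, iff_true]
  have hcol (I : Type w) [SmallCategory I] :
      (homSheaf hH).leftAdjointObjIsDefined.IsClosedUnderColimitsOfShape I := ⟨by
    rintro M ⟨c⟩
    exact Functor.leftAdjointObjIsDefined_of_isColimit c.isColimit c.prop_diag_obj⟩
  have : (homSheaf hH).leftAdjointObjIsDefined.IsClosedUnderFiniteCoproducts :=
    .of_isClosedUnderColimitsOfShape fun I _ => hcol (Discrete I)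
  have : (homSheaf hH).leftAdjointObjIsDefined.IsClosedUnderCokernels := ⟨by
    rintro _ ⟨f, k, hk, hf⟩
    refine Functor.leftAdjointObjIsDefined_of_isColimit hk ?_
    rintro (_ | _)
    exacts [hf.1, hf.2]⟩
  refine E.isCocompletion_yonedaSheaf.prop_of_isClosedUnderColimits
    (homSheaf hH).leftAdjointObjIsDefined (fun I _ _ => hcol I) (fun X => ?_) M
  have hX : (homSheaf hH ⋙ coyoneda.obj (op (E.yonedaSheaf.obj X))).CorepresentableBy
      (H.obj X) :=
    { homEquiv {Z} := (yonedaSheafEquiv (X := X) (M := (homSheaf hH).obj Z)).symm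
      homEquiv_comp {Y Z} g f := by
        apply (yonedaSheafEquiv (X := X) (M := (homSheaf hH).obj Z)).injective
        refine (Equiv.apply_symm_apply _ _).trans (Eq.trans ?_ (yonedaSheafEquiv_comp _ _).symm)
        exact congrArg (fun k : H.obj X ⟶ Y => k ≫ g) (Equiv.apply_symm_apply _ f).symm }
  exact hX.isCorepresentable

theorem exists_extension (h : IsCocompletion E J) [Preadditive B'] [HasColimitsOfSize.{w, w} B']
    {H : C ⥤ B'} (hH : E.IsRightExactOn H) :
    ∃ G : B ⥤ B', PreservesColimitsOfSize.{w, w} G ∧ Nonempty (J ⋙ G ≅ H) := by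
  have := isRightAdjoint_homSheaf hH
  have := h.isEquivalence_homSheaf
  let adj := Adjunction.ofIsRightAdjoint (homSheaf hH)
  let L := (homSheaf hH).leftAdjoint
  have := adj.leftAdjoint_preservesColimits
  -- The unit at a representable, read as a section. It is invertible because both sides corepresent
  -- the same functor.
  let α : H ⟶ E.yonedaSheaf ⋙ L :=
    { app X := yonedaSheafEquiv (adj.unit.app (E.yonedaSheaf.obj X))
      naturality X Y f := by
        have h₁ := yonedaSheafEquiv_naturality f (adj.unit.app (E.yonedaSheaf.obj Y))
        have h₂ := yonedaSheafEquiv_comp (adj.unit.app (E.yonedaSheaf.obj X))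
          ((homSheaf hH).map (L.map (E.yonedaSheaf.map f)))
        have h₃ := congrArg yonedaSheafEquiv (adj.unit.naturality (E.yonedaSheaf.map f))
        exact h₁.symm.trans (h₃.trans h₂) }
  have (X : C) : IsIso (α.app X) := by
    rw [isIso_iff_coyoneda_map_bijective]
    intro Z
    have : (fun x : L.obj (E.yonedaSheaf.obj X) ⟶ Z => α.app X ≫ x) =
        fun x => yonedaSheafEquiv (adj.homEquiv _ _ x) := by
      ext x
      rw [adj.homEquiv_unit, yonedaSheafEquiv_comp]
      rfl
    refine this ▸ ?_
    exact yonedaSheafEquiv.bijective.comp (adj.homEquiv _ _).bijective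
  have := NatIso.isIso_of_isIso_app α
  refine ⟨homSheaf h.isRightExactOn ⋙ L, inferInstance, ⟨?_⟩⟩
  exact (Functor.associator _ _ _).symm ≪≫
    Functor.isoWhiskerRight h.compHomSheafIso.symm L ≪≫ (asIso α).symm

/-- By density `𝟭 B` is the left Kan extension of `J` along itself. A functor preserving small
colimits preserves this extension, so it is determined by its restriction along `J`. -/
theorem nonempty_iso_of_comp_iso (h : IsCocompletion E J) {G G' : B ⥤ B'}
    [PreservesColimitsOfSize.{w, w} G] [PreservesColimitsOfSize.{w, w} G']
    (e : J ⋙ G ≅ J ⋙ G') : Nonempty (G ≅ G') := by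
  have := h.isDense
  have h₁ := Functor.PreservesLeftKanExtension.preserves (G := G) (𝟭 B) J.rightUnitor.inv
  have h₂ := Functor.PreservesLeftKanExtension.preserves (G := G') (𝟭 B) J.rightUnitor.inv
  exact ⟨Functor.leftKanExtensionUniqueOfIso (𝟭 B ⋙ G)
    (Functor.whiskerRight J.rightUnitor.inv G ≫ (Functor.associator _ _ _).hom) e (𝟭 B ⋙ G')
    (Functor.whiskerRight J.rightUnitor.inv G' ≫ (Functor.associator _ _ _).hom)⟩

end Extension

end IsCocompletion

end Sheaves

/-! ### Transport of exact structures and cocompletions along equivalences -/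

section Transport

variable {A : Type u₁} [Category.{v₁} A] [Preadditive A]
  {A' : Type u₂} [Category.{v₂} A'] [Preadditive A']

lemma nonempty_isColimit_cokernelCofork_map_iff (F : A ⥤ A') [F.IsEquivalence] [F.Additive]
    {X Y Z : A} {f : X ⟶ Y} {g : Y ⟶ Z} (zero : f ≫ g = 0)
    (zero' : F.map f ≫ F.map g = 0) :
    Nonempty (IsColimit (CokernelCofork.ofπ (F.map g) zero')) ↔
      Nonempty (IsColimit (CokernelCofork.ofπ g zero)) :=
  ⟨fun ⟨h⟩ => ⟨isColimitOfReflects F ((isColimitMapCoconeCoforkEquiv' F zero).symm h)⟩,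
    fun ⟨h⟩ => ⟨isColimitCoforkMapOfIsColimit' F zero h⟩⟩

lemma nonempty_isLimit_kernelFork_map_iff (F : A ⥤ A') [F.IsEquivalence] [F.Additive]
    {X Y Z : A} {f : X ⟶ Y} {g : Y ⟶ Z} (zero : f ≫ g = 0)
    (zero' : F.map f ≫ F.map g = 0) :
    Nonempty (IsLimit (KernelFork.ofι (F.map f) zero')) ↔
      Nonempty (IsLimit (KernelFork.ofι f zero)) :=
  ⟨fun ⟨h⟩ => ⟨isLimitOfReflects F ((isLimitMapConeForkEquiv' F zero).symm h)⟩,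
    fun ⟨h⟩ => ⟨isLimitForkMapOfIsLimit' F zero h⟩⟩

variable [HasZeroObject A] [HasBinaryBiproducts A] [HasZeroObject A'] [HasBinaryBiproducts A']

namespace ExactStructure

lemma conflation_map_iff {E : ExactStructure A} {E' : ExactStructure A'} (F : A ⥤ A')
    [F.IsEquivalence] [F.Additive]
    (hF : ∀ ⦃X Y : A⦄ (f : X ⟶ Y), E.inflation f ↔ E'.inflation (F.map f))
    {X Y Z : A} (f : X ⟶ Y) (g : Y ⟶ Z) :
    E.Conflation f g ↔ E'.Conflation (F.map f) (F.map g) := by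
  refine and_congr (hF f) ⟨fun ⟨zero, h⟩ => ?_, fun ⟨zero', h⟩ => ?_⟩
  · have zero' : F.map f ≫ F.map g = 0 := by rw [← F.map_comp, zero, F.map_zero]
    exact ⟨zero', (nonempty_isColimit_cokernelCofork_map_iff F zero zero').2 h⟩
  · have zero : f ≫ g = 0 := F.map_injective (by rw [F.map_comp, zero', F.map_zero])
    exact ⟨zero, (nonempty_isColimit_cokernelCofork_map_iff F zero zero').1 h⟩

instance (E : ExactStructure A) : E.inflation.RespectsIso :=
  MorphismProperty.RespectsIso.mk _
    (fun e _ hf => E.inflation_comp _ _ (E.inflation_of_isIso e.hom) hf)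
    (fun e _ hf => E.inflation_comp _ _ hf (E.inflation_of_isIso e.hom))

instance (E : ExactStructure A) : E.deflation.RespectsIso :=
  MorphismProperty.RespectsIso.mk _
    (fun e _ hf => E.deflation_comp _ _ (E.deflation_of_isIso e.hom) hf)
    (fun e _ hf => E.deflation_comp _ _ hf (E.deflation_of_isIso e.hom))

/-- The exact structure induced along an additive equivalence. -/
def induced (E : ExactStructure A') (F : A ⥤ A') [F.IsEquivalence] [F.Additive] :
    ExactStructure A where
  inflation := E.inflation.inverseImage F
  deflation := E.deflation.inverseImage F
  inflation_of_isIso f _ := E.inflation_of_isIso (F.map f)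
  deflation_of_isIso f _ := E.deflation_of_isIso (F.map f)
  inflation_comp f g hf hg := by
    simpa [MorphismProperty.inverseImage_iff] using E.inflation_comp _ _ hf hg
  deflation_comp f g hf hg := by
    simpa [MorphismProperty.inverseImage_iff] using E.deflation_comp _ _ hf hg
  exists_cokernel {X Y} f hf := by
    obtain ⟨Z, g, h⟩ := exists_conflation_of_inflation (E := E) hf
    let e := F.objObjPreimageIso Z
    let g' : Y ⟶ F.objPreimage Z := F.preimage (g ≫ e.inv)
    have hg' : F.map g' = g ≫ e.inv := F.map_preimage _
    have zero' : F.map f ≫ F.map g' = 0 := by rw [hg', reassoc_of% h.zero, zero_comp]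
    have zero : f ≫ g' = 0 := F.map_injective (by rw [F.map_comp, zero', F.map_zero])
    have h' : E.Conflation (F.map f) (F.map g') := by
      have := h.epi
      refine ⟨h.1, zero', ?_⟩
      have : Epi (F.map g') := by rw [hg']; infer_instance
      refine ⟨CokernelCofork.IsColimit.ofπ' _ _ fun {T} k hk => Nonempty.some ?_⟩
      obtain ⟨l, hl⟩ := h.exists_desc k hk
      exact ⟨⟨e.hom ≫ l, by simp [hg', hl]⟩⟩
    exact ⟨_, g', zero, h'.deflation,
      (nonempty_isColimit_cokernelCofork_map_iff F zero zero').1 h'.2.2,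
      (nonempty_isLimit_kernelFork_map_iff F zero zero').1 h'.nonempty_isLimit⟩
  exists_kernel {Y Z} g hg := by
    obtain ⟨X, f, h⟩ := exists_conflation_of_deflation (E := E) hg
    let e := F.objObjPreimageIso X
    let f' : F.objPreimage X ⟶ Y := F.preimage (e.hom ≫ f)
    have hf' : F.map f' = e.hom ≫ f := F.map_preimage _
    have zero' : F.map f' ≫ F.map g = 0 := by rw [hf', Category.assoc, h.zero, comp_zero]
    have zero : f' ≫ g = 0 := F.map_injective (by rw [F.map_comp, zero', F.map_zero])
    have h' : E.Conflation (F.map f') (F.map g) := by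
      have := h.epi
      refine ⟨hf' ▸ E.inflation_comp _ _ (E.inflation_of_isIso _) h.1, zero',
        ⟨CokernelCofork.IsColimit.ofπ' _ _ fun {T} k hk => Nonempty.some ?_⟩⟩
      obtain ⟨l, hl⟩ := h.exists_desc k ((cancel_epi e.hom).1 (by
        rw [← Category.assoc, ← hf', hk, comp_zero]))
      exact ⟨⟨l, hl⟩⟩
    exact ⟨_, f', zero, h'.1,
      (nonempty_isLimit_kernelFork_map_iff F zero zero').1 h'.nonempty_isLimit,
      (nonempty_isColimit_cokernelCofork_map_iff F zero zero').1 h'.2.2⟩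
  cobase_change {X Y X'} f g hf := by
    obtain ⟨P, a, b, sq, hb⟩ := E.cobase_change (F.map f) (F.map g) hf
    let e := F.objObjPreimageIso P
    have h : IsPushout (F.map f) (F.map g) (F.map (F.preimage (a ≫ e.inv)))
        (F.map (F.preimage (b ≫ e.inv))) :=
      sq.of_iso (Iso.refl _) (Iso.refl _) (Iso.refl _) e.symm (by simp) (by simp) (by simp)
        (by simp)
    exact ⟨_, _, _, IsPushout.of_map_of_faithful F h, E.inflation_of_isPushout h hf⟩
  base_change {X Y Y'} f g hf := by
    obtain ⟨P, a, b, sq, hb⟩ := E.base_change (F.map f) (F.map g) hf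
    let e := F.objObjPreimageIso P
    have h : IsPullback (F.map (F.preimage (e.hom ≫ a))) (F.map (F.preimage (e.hom ≫ b)))
        (F.map f) (F.map g) :=
      sq.of_iso' e (Iso.refl _) (Iso.refl _) (Iso.refl _) (by simp) (by simp) (by simp)
        (by simp)
    exact ⟨_, _, _, IsPullback.of_map_of_faithful F h, E.deflation_of_isPullback h hf⟩

end ExactStructure

namespace IsCocompletion

open ExactStructure

variable {B : Type u₃} [Category.{w} B] [Abelian B]

lemma comp_of_isEquivalence {E : ExactStructure A} {E' : ExactStructure A'} {J : A' ⥤ B}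
    (h : IsCocompletion E' J) (F : A ⥤ A') [F.IsEquivalence] [F.Additive]
    (hi : ∀ ⦃X Y : A⦄ (f : X ⟶ Y), E.inflation f ↔ E'.inflation (F.map f))
    (hd : ∀ ⦃X Y : A⦄ (f : X ⟶ Y), E.deflation f ↔ E'.deflation (F.map f)) :
    IsCocompletion E (F ⋙ J) where
  cocomplete := h.cocomplete
  fullyExact :=
    have := h.fullyExact.full
    have := h.fullyExact.faithful
    ⟨inferInstance, inferInstance, fun _ _ _ f g =>
      (conflation_map_iff F hi f g).trans (h.fullyExact.conflation_iff _ _)⟩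
  finitelyPresented X := h.finitelyPresented (F.obj X)
  exists_ne_zero Y hY := by
    obtain ⟨X, f, hf⟩ := h.exists_ne_zero Y hY
    refine ⟨F.objPreimage X, J.map (F.objObjPreimageIso X).hom ≫ f, fun h0 => hf ?_⟩
    exact (cancel_epi (J.map (F.objObjPreimageIso X).hom)).1 (h0.trans comp_zero.symm)
  exists_lift X U V φ _ f := by
    obtain ⟨Y, g, k, hg, hk⟩ := h.exists_lift (F.obj X) φ f
    refine ⟨F.objPreimage Y, F.preimage ((F.objObjPreimageIso Y).hom ≫ g),
      J.map (F.objObjPreimageIso Y).hom ≫ k, (hd _).2 ?_, ?_⟩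
    · rw [F.map_preimage]
      exact E'.deflation_comp _ _ (E'.deflation_of_isIso _) hg
    · rw [Functor.comp_map, F.map_preimage, Category.assoc, hk, J.map_comp, Category.assoc]

lemma of_comp_isEquivalence {E : ExactStructure A} {J : A ⥤ B} {B' : Type u} [Category.{w} B']
    [Abelian B'] (F : B ⥤ B') [F.IsEquivalence] [F.Additive] (h : IsCocompletion E (J ⋙ F)) :
    IsCocompletion E J where
  cocomplete :=
    have := h.cocomplete
    Adjunction.has_colimits_of_equivalence F
  fullyExact :=
    have := h.fullyExact.full
    have := h.fullyExact.faithful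
    { full := .of_comp_faithful J F
      faithful := .of_comp J F
      conflation_iff _ _ _ f g := (h.fullyExact.conflation_iff f g).trans
        (conflation_map_iff F (fun _ _ k => (F.mono_map_iff_mono k).symm) _ _).symm }
  finitelyPresented X :=
    have : Fact Cardinal.aleph0.{w}.IsRegular := Cardinal.fact_isRegular_aleph0
    (isCardinalPresentable_iff_of_isEquivalence (J.obj X) Cardinal.aleph0.{w} F).1
      (h.finitelyPresented X)
  exists_ne_zero Y hY := by
    obtain ⟨X, f, hf⟩ := h.exists_ne_zero (F.obj Y) fun h0 => hY ((IsZero.iff_id_eq_zero _).2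
      (F.map_injective (h0.eq_of_src _ _)))
    obtain ⟨f, rfl⟩ := F.map_surjective f
    exact ⟨X, f, fun h0 => hf (by rw [h0, F.map_zero])⟩
  exists_lift X U V φ _ f := by
    obtain ⟨Y, g, k, hg, hk⟩ := h.exists_lift X (F.map φ) (F.map f)
    obtain ⟨k, rfl⟩ := F.map_surjective k
    exact ⟨Y, g, k, hg, F.map_injective (by rw [F.map_comp, hk, F.map_comp, Functor.comp_map])⟩

end IsCocompletion

end Transport

/-! ### Making functors strict on objects -/

section Strictification

variable {A : Type u} [Category.{v} A] [Preadditive A] [HasZeroObject A] [HasBinaryBiproducts A]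
  {B : Type u₁} [Category.{w} B] [Abelian B]

/-- `B` is replaced by an equivalent category with objects `A ⊕ B`: the left summand makes the
embedding injective, the right one keeps the projection to `B` essentially surjective. -/
lemma IsCocompletion.exists_isStrictCocompletion {E : ExactStructure A} {J : A ⥤ B}
    (h : IsCocompletion E J) :
    ∃ (B' : Type (max u u₁)) (_ : Category.{w} B') (_ : Abelian B') (J' : A ⥤ B'),
      IsStrictCocompletion E J' := by
  let p : A ⊕ B → B := Sum.elim J.obj id
  let F : InducedCategory B p ⥤ B := inducedFunctor p
  have : F.EssSurj := ⟨fun Y => ⟨Sum.inr Y, ⟨Iso.refl _⟩⟩⟩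
  have : F.IsEquivalence := { }
  let hF := Functor.FullyFaithful.ofFullyFaithful F
  let _ : Preadditive (InducedCategory B p) := .ofFullyFaithful hF
  have : F.Additive := hF.additive_ofFullyFaithful
  have : HasFiniteProducts (InducedCategory B p) :=
    ⟨fun n => Adjunction.hasLimitsOfShape_of_equivalence F⟩
  let _ : Abelian (InducedCategory B p) := abelianOfEquivalence F
  let J' : A ⥤ InducedCategory B p :=
    { obj X := (Sum.inl X : A ⊕ B)
      map f := InducedCategory.homMk (J.map f) }
  refine ⟨InducedCategory B p, inferInstance, inferInstance, J', ?_, Sum.inl_injective⟩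
  exact IsCocompletion.of_comp_isEquivalence (J := J') F h

end Strictification

/-- A functor `G` may be replaced by an isomorphic one whose composition with a functor that is
injective on objects is equal to a given functor isomorphic to it. -/
lemma CategoryTheory.Functor.exists_iso_of_comp_iso {A : Type u} [Category.{v} A] {B : Type u₁}
    [Category.{v₁} B] {D : Type u₂} [Category.{v₂} D] {J : A ⥤ B}
    (hJ : Function.Injective J.obj) {G : B ⥤ D} {K : A ⥤ D} (i : J ⋙ G ≅ K) :
    ∃ G' : B ⥤ D, J ⋙ G' = K ∧ Nonempty (G ≅ G') := by
  classical
  -- The new value at `Y` is chosen together with its isomorphism from `G.obj Y`. On the image of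
  -- `J` both are prescribed, unambiguously by injectivity.
  have hs (Y : B) : ∃ s : Σ Z, G.obj Y ≅ Z, ∀ (X : A) (hX : J.obj X = Y),
      s = ⟨K.obj X, G.mapIso (eqToIso hX.symm) ≪≫ i.app X⟩ := by
    by_cases h : ∃ X, J.obj X = Y
    · obtain ⟨X, rfl⟩ := h
      refine ⟨⟨K.obj X, i.app X⟩, fun X' hX' => ?_⟩
      obtain rfl := hJ hX'
      simp
    · exact ⟨⟨_, Iso.refl _⟩, fun X hX => (h ⟨X, hX⟩).elim⟩
  choose s hs using hs
  have hs' (X : A) : s (J.obj X) = ⟨K.obj X, i.app X⟩ := by simpa using hs (J.obj X) X rfl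
  refine ⟨G.copyObj (fun Y => (s Y).1) fun Y => (s Y).2, ?_, ⟨G.isoCopyObj _ _⟩⟩
  refine Functor.hext (fun X => congrArg Sigma.fst (hs' X)) fun X Y f => ?_
  have key {M N : D} (a : M ⟶ N) {s₁ t₁ : Σ Z, M ≅ Z} {s₂ t₂ : Σ Z, N ≅ Z} (h₁ : s₁ = t₁)
      (h₂ : s₂ = t₂) : s₁.2.inv ≫ a ≫ s₂.2.hom ≍ t₁.2.inv ≫ a ≫ t₂.2.hom := by
    subst h₁ h₂
    rfl
  refine (key (G.map (J.map f)) (hs' X) (hs' Y)).trans (heq_of_eq ?_)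
  exact (Iso.inv_comp_eq _).2 (i.hom.naturality f)

lemma IsRightExactRespectingDirectSums.preservesColimits {B : Type u₁} [Category.{w} B]
    {B' : Type u₂} [Category.{w} B'] [HasColimitsOfSize.{w, w} B] {G : B ⥤ B'}
    (hG : IsRightExactRespectingDirectSums G) : PreservesColimitsOfSize.{w, w} G := by
  have := hG.rightExact
  have := hG.directSums
  exact preservesColimits_of_preservesCoequalizers_and_coproducts G

lemma IsRightExactRespectingDirectSums.of_preservesColimits {B : Type u₁} [Category.{w} B]
    {B' : Type u₂} [Category.{w} B'] (G : B ⥤ B') [PreservesColimitsOfSize.{w, w} G] :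
    IsRightExactRespectingDirectSums G :=
  ⟨PreservesColimitsOfSize.preservesFiniteColimits G, fun _ => inferInstance⟩

/-! ### Reduction from essentially small to small categories -/

lemma CategoryTheory.EssentiallySmall.exists_isEquivalence_additive (A : Type u) [Category.{v} A]
    [Preadditive A] [HasZeroObject A] [HasBinaryBiproducts A] [EssentiallySmall.{w} A] :
    ∃ (C : Type w) (_ : Category.{w} C) (_ : Preadditive C) (_ : HasZeroObject C)
      (_ : HasBinaryBiproducts C) (F : C ⥤ A), F.IsEquivalence ∧ F.Additive := by
  let e := equivSmallModel.{w} A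
  let _ : Preadditive (SmallModel.{w} A) := .ofFullyFaithful e.fullyFaithfulInverse
  have : e.inverse.Additive := e.fullyFaithfulInverse.additive_ofFullyFaithful
  have : HasZeroObject (SmallModel.{w} A) :=
    ⟨e.functor.obj _, e.functor.map_isZero (HasZeroObject.zero (C := A)).choose_spec⟩
  have : HasBinaryProducts (SmallModel.{w} A) :=
    Adjunction.hasLimitsOfShape_of_equivalence e.inverse
  exact ⟨_, inferInstance, inferInstance, inferInstance, .of_hasBinaryProducts, e.inverse,
    inferInstance, inferInstance⟩

/-- Precomposition with an equivalence reflects isomorphisms of functors. -/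
noncomputable def CategoryTheory.Functor.isoOfCompIso {C : Type u} [Category.{v} C] {A : Type u₁}
    [Category.{v₁} A] {D : Type u₂} [Category.{v₂} D] (S : C ⥤ A) [S.IsEquivalence]
    {K K' : A ⥤ D} (i : S ⋙ K ≅ S ⋙ K') : K ≅ K' :=
  ((S.asEquivalence.congrLeft (E := D)).fullyFaithfulInverse).preimageIso i

namespace IsCocompletion

open ExactStructure

variable {A : Type u} [Category.{v} A] [Preadditive A] [HasZeroObject A] [HasBinaryBiproducts A]
  {B : Type u₁} [Category.{w} B] [Abelian B] {E : ExactStructure A} {J : A ⥤ B}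

lemma induced (h : IsCocompletion E J) {C : Type u₂} [Category.{v₂} C] [Preadditive C]
    [HasZeroObject C] [HasBinaryBiproducts C] (S : C ⥤ A) [S.IsEquivalence] [S.Additive] :
    IsCocompletion (E.induced S) (S ⋙ J) :=
  h.comp_of_isEquivalence S (fun _ _ _ => Iff.rfl) (fun _ _ _ => Iff.rfl)

theorem generatedByDirectSums_of_essentiallySmall [EssentiallySmall.{w} A]
    (h : IsCocompletion E J) : GeneratedByDirectSums J := by
  obtain ⟨C, _, _, _, _, S, _, _⟩ := EssentiallySmall.exists_isEquivalence_additive.{w} A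
  intro Y
  obtain ⟨ι, X, hX, p, hp⟩ := (h.induced S).generatedByDirectSums Y
  exact ⟨ι, fun i => S.obj (X i), hX, p, hp⟩

theorem isGrothendieckAbelian_of_essentiallySmall [EssentiallySmall.{w} A]
    (h : IsCocompletion E J) : IsGrothendieckAbelian.{w} B := by
  obtain ⟨C, _, _, _, _, S, _, _⟩ := EssentiallySmall.exists_isEquivalence_additive.{w} A
  exact (h.induced S).isGrothendieckAbelian

/-- Both cocompletions are equivalent to the additive sheaves on the same small model, compatibly
with Yoneda. -/
theorem exists_equivalence [EssentiallySmall.{w} A] {B' : Type u₂} [Category.{w} B'] [Abelian B']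
    {J' : A ⥤ B'} (h : IsCocompletion E J) (h' : IsCocompletion E J') :
    ∃ e : B ≌ B', Nonempty (J ⋙ e.functor ≅ J') := by
  obtain ⟨C, _, _, _, _, S, _, _⟩ := EssentiallySmall.exists_isEquivalence_additive.{w} A
  have := (h.induced S).isEquivalence_homSheaf
  have := (h'.induced S).isEquivalence_homSheaf
  let N := (homSheaf (h.induced S).isRightExactOn).asEquivalence
  let N' := (homSheaf (h'.induced S).isRightExactOn).asEquivalence
  let i : (S ⋙ J) ⋙ N.functor ≅ (S ⋙ J') ⋙ N'.functor :=
    (h.induced S).compHomSheafIso.symm ≪≫ (h'.induced S).compHomSheafIso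
  let j : S ⋙ J ⋙ (N.trans N'.symm).functor ≅ S ⋙ J' :=
    Functor.isoWhiskerRight i N'.inverse ≪≫ Functor.isoWhiskerLeft (S ⋙ J') N'.unitIso.symm ≪≫
      (S ⋙ J').rightUnitor
  exact ⟨N.trans N'.symm, ⟨S.isoOfCompIso j⟩⟩

theorem exists_extension_of_essentiallySmall [EssentiallySmall.{w} A] {B' : Type u₂}
    [Category.{w} B'] [Abelian B'] [HasColimitsOfSize.{w, w} B'] (h : IsCocompletion E J)
    {H : A ⥤ B'} (hH : E.IsRightExactOn H) :
    ∃ G : B ⥤ B', PreservesColimitsOfSize.{w, w} G ∧ Nonempty (J ⋙ G ≅ H) := by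
  obtain ⟨C, _, _, _, _, S, _, _⟩ := EssentiallySmall.exists_isEquivalence_additive.{w} A
  have hS : (E.induced S).IsExactFunctor E S := fun _ _ _ f g =>
    (conflation_map_iff S (fun _ _ _ => Iff.rfl) f g).1
  obtain ⟨G, hG, ⟨i⟩⟩ := (h.induced S).exists_extension (hS.comp_isRightExactOn hH)
  exact ⟨G, hG, ⟨S.isoOfCompIso i⟩⟩

theorem nonempty_iso_of_comp_iso_of_essentiallySmall [EssentiallySmall.{w} A] {B' : Type u₂}
    [Category.{w} B'] (h : IsCocompletion E J) {G G' : B ⥤ B'}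
    [PreservesColimitsOfSize.{w, w} G] [PreservesColimitsOfSize.{w, w} G']
    (e : J ⋙ G ≅ J ⋙ G') : Nonempty (G ≅ G') := by
  obtain ⟨C, _, _, _, _, S, _, _⟩ := EssentiallySmall.exists_isEquivalence_additive.{w} A
  exact (h.induced S).nonempty_iso_of_comp_iso (Functor.isoWhiskerLeft S e)

end IsCocompletion

namespace ExactStructure

variable {A : Type u} [Category.{v} A] [Preadditive A] [HasZeroObject A] [HasBinaryBiproducts A]

theorem exists_isStrictCocompletion [EssentiallySmall.{w} A] (E : ExactStructure A) :
    ∃ (B : Type (max u (w + 1))) (_ : Category.{w} B) (_ : Abelian B) (J : A ⥤ B),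
      IsStrictCocompletion E J := by
  obtain ⟨C, _, _, _, _, S, _, _⟩ := EssentiallySmall.exists_isEquivalence_additive.{w} A
  have : S.asEquivalence.functor.Additive := ‹_›
  have : S.inv.Additive := S.asEquivalence.inverse_additive
  -- Inflations and deflations are invariant under isomorphism of arrows, so `S.inv` matches `E`
  -- with its induced structure.
  let e {X Y : A} (f : X ⟶ Y) : Arrow.mk f ≅ Arrow.mk (S.map (S.inv.map f)) :=
    Arrow.isoMk (S.asEquivalence.counitIso.symm.app X) (S.asEquivalence.counitIso.symm.app Y)
      (S.asEquivalence.counitIso.inv.naturality f).symm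
  have h := (E.induced S).isCocompletion_yonedaSheaf.comp_of_isEquivalence (E := E) S.inv
    (fun _ _ f => E.inflation.arrow_mk_iso_iff (e f))
    (fun _ _ f => E.deflation.arrow_mk_iso_iff (e f))
  exact h.exists_isStrictCocompletion

end ExactStructure

theorem theorem4 {A : Type u} [Category.{v} A] [Preadditive A] [HasZeroObject A]
    [HasBinaryBiproducts A] [EssentiallySmall.{w} A] (E : ExactStructure A) :
    -- existence of a strict cocompletion
    (∃ (B : Type (max u (w + 1))) (_ : Category.{w} B) (_ : Abelian B) (J : A ⥤ B),
      IsStrictCocompletion E J) ∧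
    -- uniqueness up to an equivalence under `A`
    (∀ {B : Type u₁} [Category.{w} B] [Abelian B] {B' : Type u₂} [Category.{w} B'] [Abelian B']
      (J : A ⥤ B) (J' : A ⥤ B'), IsStrictCocompletion E J → IsStrictCocompletion E J' →
      ∃ e : B ≌ B', Nonempty (J ⋙ e.functor ≅ J')) ∧
    -- further properties of every cocompletion
    (∀ {B : Type u₁} [Category.{w} B] [Abelian B] (J : A ⥤ B), IsCocompletion E J →
      IsGrothendieckAbelian.{w} B ∧ GeneratedByDirectSums J ∧ StableUnderExtensions E J ∧
        EpiIffStablyDeflation E J) ∧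
    -- extension of exact functors to strict cocompletions
    (∀ {A' : Type u₃} [Category.{v₁} A'] [Preadditive A'] [HasZeroObject A']
      [HasBinaryBiproducts A'] [EssentiallySmall.{w} A'] (E' : ExactStructure A')
      {B : Type u₁} [Category.{w} B] [Abelian B] {B' : Type u₂} [Category.{w} B'] [Abelian B']
      (J : A ⥤ B) (J' : A' ⥤ B'), IsStrictCocompletion E J → IsStrictCocompletion E' J' →
      ∀ F : A ⥤ A', E.IsExactFunctor E' F →
        ∃ G : B ⥤ B', J ⋙ G = F ⋙ J' ∧ IsRightExactRespectingDirectSums G ∧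
          ∀ G' : B ⥤ B', Nonempty (J ⋙ G' ≅ F ⋙ J') → IsRightExactRespectingDirectSums G' →
            Nonempty (G' ≅ G)) := by
  refine ⟨E.exists_isStrictCocompletion, ?_, ?_, ?_⟩
  · intro B _ _ B' _ _ J J' h h'
    exact h.toIsCocompletion.exists_equivalence h'.toIsCocompletion
  · intro B _ _ J h
    exact ⟨h.isGrothendieckAbelian_of_essentiallySmall,
      h.generatedByDirectSums_of_essentiallySmall, h.stableUnderExtensions,
      h.epiIffStablyDeflation⟩
  · intro A' _ _ _ _ _ E' B _ _ B' _ _ J J' h h' F hF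
    have := h.cocomplete
    have := h'.cocomplete
    obtain ⟨G₀, hG₀, ⟨i₀⟩⟩ := h.exists_extension_of_essentiallySmall
      (hF.comp_isRightExactOn h'.isRightExactOn)
    -- The extension so far agrees with the given functor only up to isomorphism; strictness of `J`
    -- upgrades this to an equality.
    obtain ⟨G, hG, ⟨i⟩⟩ := Functor.exists_iso_of_comp_iso h.injective_obj i₀
    have := preservesColimits_of_natIso i
    refine ⟨G, hG, .of_preservesColimits G, fun G' ⟨j⟩ hG' => ?_⟩
    have := hG'.preservesColimits
    exact h.nonempty_iso_of_comp_iso_of_essentiallySmall (j ≪≫ eqToIso hG.symm)
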